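/- **Setting.** Consider a constrained Markov decision process with countable state space $\mathcal S$, countable action space $\mathcal A$, transition probabilities $P(\cdot\mid s,a)$, discount rate $\gamma\in(0,1)$, initial distribution $\mu_0$, cost $c(s,a)$, auxiliary costs $d_1,\dots,d_K$ and thresholds $q\in\mathbb R^K$. A stationary policy $\pi$ assigns to each state $s$ a probability distribution $\pi(\cdot\mid s)$ on $\mathcal A$; a mixing policy is a probability measure on the set $\Pi_S$ of stationary policies, from which a policy is drawn once and then executed forever; $\mathcal M(\Pi_S)$ is the set of mixing policies. Put $$C(\pi)=(1-\gamma)\,\mathbb E^\pi_{s_0\sim\mu_0}\Big[\sum_{t\ge0}\gamma^t c(s_t,a_t)\Big],\qquad D_k(\pi)=(1-\gamma)\,\mathbb E^\pi_{s_0\sim\mu_0}\Big[\sum_{t\ge0}\gamma^t d_k(s_t,a_t)\Big],$$ $D=(D_1,\dots,D_K)$, $L(\pi,\lambda)=C(\pi)+\sum_k\lambda_k(D_k(\pi)-q_k)$, $c^\lambda=c+\sum_k\lambda_k(d_k-q_k)$ and $$Q^{\pi,\lambda}(s,a)=(1-\gamma)\,\mathbb E^\pi\Big[\sum_{t\ge0}\gamma^t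 c^\lambda(s_t,a_t)\,\Big|\,s_0=s,\ a_0=a\Big].$$ Let $\pi^*$ minimize $C$ over $\{\pi\in\mathcal M(\Pi_S):D(\pi)\le q\}$ and let $\lambda^*$ maximize $\lambda\mapsto\inf_{\pi\in\mathcal M(\Pi_S)}L(\pi,\lambda)$ over $\lambda\ge0$. Let $M\ge\|\lambda^*\|$, $r>0$ and $\Lambda_M=\{\lambda\in\mathbb R^K_+:\|\lambda\|\le M+r\}$ (Euclidean norm). Given step sizes $\eta_m>0$, a stationary policy $\pi_0$ and $\lambda_0\in\Lambda_M$, let $$\lambda_{m+1}=\mathrm{Proj}_{\Lambda_M}\big(\lambda_m+\eta_m(D(\pi_m)-q)\big),\qquad \pi_{m+1}(\cdot\mid s)\propto\pi_m(\cdot\mid s)\exp\big(-\eta_mQ^{\pi_m,\lambda_m}(s,\cdot)\big),$$ and let $\bar\pi_T$ be the mixing policy that executes $\pi_m$, $0\le m<T$, with probability $\eta_m/\sum_{j<T}\eta_j$. Let $\nu^{\pi^*}(s,a)=(1-\gamma)\sum_t\gamma^tP^{\pi^*}_{s_0\sim\mu_0}(s_t=s,a_t=a)$ be the occupation measure of $\pi^*$,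 $\nu_s^{\pi^*}(s)=\sum_a\nu^{\pi^*}(s,a)$, $\tilde\pi^*(a\mid s)=\nu^{\pi^*}(s,a)/\nu_s^{\pi^*}(s)$, and $$\Phi=\sum_s\nu_s^{\pi^*}(s)\,\mathrm{KL}\big(\tilde\pi^*(\cdot\mid s)\,\|\,\pi_0(\cdot\mid s)\big),\qquad R^2=\max_{\lambda\in\Lambda_M}\|\lambda-\lambda_0\|^2.$$ **Theorem.** Assume that (i) there is a constant $W$ with $c(s,a)>W$ and $d_k(s,a)>W$ for all $s,a,k$; (ii) there is a mixing policy $\tilde\pi$ with $D_k(\tilde\pi)<q_k$ for all $k$; (iii) there is $G>0$ such that for all $\lambda\in\Lambda_M$ and $\pi\in\mathcal M(\Pi_S)$ one has $\|D(\pi)-q\|\le G$ and $\sup_{s,a}|Q^{\pi,\lambda}(s,a)|\le G$ (all these expectations being finite); and that $\Phi<\infty$ (otherwise the bounds below are void). (a) If $\eta_m=\Theta(1/\sqrt m)$, then there are constants $\kappa_1,\kappa_2>0$, depending only on the step sizes, such that for all $T\ge2$ $$\big\|[D(\bar\pi_T)-q]^+\big\|\le\Big(R^2+\tfrac58G^2\kappa_2\log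 T+\Phi\Big)\frac1{2r(1-\gamma)\kappa_1\sqrt T},$$ $$C(\bar\pi_T)-L(\pi^*,\lambda^*)\le\Big(\tfrac58G^2\kappa_2\log T+\Phi+\tfrac12\|\lambda_0\|^2\Big)\frac1{(1-\gamma)\kappa_1\sqrt T},$$ $$C(\bar\pi_T)-L(\pi^*,\lambda^*)\ge-\|\lambda^*\|\Big(R^2+\tfrac58G^2\kappa_2\log T+\Phi\Big)\frac1{2r(1-\gamma)\kappa_1\sqrt T};$$ in particular both $\|[D(\bar\pi_T)-q]^+\|$ and $|C(\bar\pi_T)-L(\pi^*,\lambda^*)|$ are $O(\log T/\sqrt T)$. (b) If $\eta_m=\eta>0$ for all $m$, then for all $T\ge1$ $$\big\|[D(\bar\pi_T)-q]^+\big\|\le\Big(R^2+\frac{2\Phi}{1-\gamma}\Big)\frac1{2rT\eta}+\Big(1+\frac1{1-\gamma}\Big)\frac{G^2\eta}{2r},$$ $$C(\bar\pi_T)-L(\pi^*,\lambda^*)\le\Big(\frac{\Phi}{1-\gamma}+\frac{\|\lambda_0\|^2}2\Big)\frac1{T\eta}+\Big(\frac12+\frac1{2(1-\gamma)}\Big)G^2\eta,$$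 $$C(\bar\pi_T)-L(\pi^*,\lambda^*)\ge-\|\lambda^*\|\left[\Big(R^2+\frac{2\Phi}{1-\gamma}\Big)\frac1{2rT\eta}+\Big(1+\frac1{1-\gamma}\Big)\frac{G^2\eta}{2r}\right];$$ in particular both quantities are $O(1/(\eta T)+\eta)$. -/

import Mathlib

open MeasureTheory ProbabilityTheory Filter
open scoped ENNReal

/-- A constrained Markov decision process with countable state space `S`, countable action space
`A` and `K` auxiliary costs: transition kernel `P`, discount rate `γ ∈ (0,1)`, initial
distribution `μ₀`, cost `c`, auxiliary costs `d k` and thresholds `q k`. -/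
structure CMDP (S A : Type*) [MeasurableSpace S] [MeasurableSpace A] (K : ℕ) where
  P : Kernel (S × A) S
  markov : IsMarkovKernel P
  γ : ℝ
  γ_pos : 0 < γ
  γ_lt_one : γ < 1
  μ₀ : ProbabilityMeasure S
  c : S → A → ℝ
  d : Fin K → S → A → ℝ
  q : EuclideanSpace ℝ (Fin K)

/-- Stationary (randomized) policies: `π s` is the law of the action taken in state `s`.
The space of stationary policies carries the product `σ`-algebra, so that a mixing stationary
policy is a probability measure on `StationaryPolicy S A`. -/
abbrev StationaryPolicy (S A : Type*) [MeasurableSpace A] := S → ProbabilityMeasure A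

namespace CMDP

noncomputable section

variable {S A : Type*} [Countable S] [MeasurableSpace S] [MeasurableSingletonClass S]
  [MeasurableSpace A] {K : ℕ}

/-- A stationary policy as a Markov kernel. -/
def policyKernel (π : StationaryPolicy S A) : Kernel S A :=
  Kernel.ofFunOfCountable fun s => (π s : Measure A)

/-- The law of `(s_t, a_t)` under the stationary policy `π` when `(s_0, a_0)` has law `ν`:
`s_{t+1} ∼ P(· | s_t, a_t)` and `a_{t+1} ∼ π(· | s_{t+1})`. -/
def law (X : CMDP S A K) (π : StationaryPolicy S A) (ν : Measure (S × A)) :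
    ℕ → Measure (S × A)
  | 0 => ν
  | t + 1 => ((X.law π ν t).bind X.P) ⊗ₘ policyKernel π

/-- The law of `(s_0, a_0)` when `s_0 ∼ μ₀` and `a_0 ∼ π(· | s_0)`. -/
def initLaw (X : CMDP S A K) (π : StationaryPolicy S A) : Measure (S × A) :=
  (X.μ₀ : Measure S) ⊗ₘ policyKernel π

/-- `(1 - γ) E[∑ₜ γ^t f(s_t, a_t)]` under `π`, when `(s_0, a_0)` has law `ν`. -/
def discounted (X : CMDP S A K) (f : S → A → ℝ) (π : StationaryPolicy S A)
    (ν : Measure (S × A)) : ℝ :=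
  (1 - X.γ) * ∑' t : ℕ, X.γ ^ t * ∫ x, f x.1 x.2 ∂(X.law π ν t)

/-- The discounted cost is well defined and finite: `E[∑ₜ γ^t |f(s_t, a_t)|] < ∞`. -/
def FiniteDiscounted (X : CMDP S A K) (f : S → A → ℝ) (π : StationaryPolicy S A)
    (ν : Measure (S × A)) : Prop :=
  (∀ t, Integrable (fun x : S × A => f x.1 x.2) (X.law π ν t)) ∧
    Summable fun t : ℕ => X.γ ^ t * ∫ x, |f x.1 x.2| ∂(X.law π ν t)

/-- `C(π)` for a mixing policy `ρ` (a measure on stationary policies). -/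
def cost (X : CMDP S A K) (ρ : Measure (StationaryPolicy S A)) : ℝ :=
  ∫ π, X.discounted X.c π (X.initLaw π) ∂ρ

/-- The vector `D(π) = (D_1(π), …, D_K(π))` for a mixing policy `ρ`. -/
def auxCost (X : CMDP S A K) (ρ : Measure (StationaryPolicy S A)) : EuclideanSpace ℝ (Fin K) :=
  WithLp.toLp 2 fun k => ∫ π, X.discounted (X.d k) π (X.initLaw π) ∂ρ

/-- The Lagrangian `L(π, l) = C(π) + ∑ₖ l_k (D_k(π) - q_k)`. -/
def lagrangian (X : CMDP S A K) (ρ : Measure (StationaryPolicy S A))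
    (l : EuclideanSpace ℝ (Fin K)) : ℝ :=
  X.cost ρ + ∑ k, l k * (X.auxCost ρ k - X.q k)

/-- The modified instantaneous cost `c^l(s,a) = c(s,a) + ∑ₖ l_k (d_k(s,a) - q_k)`. -/
def modCost (X : CMDP S A K) (l : EuclideanSpace ℝ (Fin K)) (s : S) (a : A) : ℝ :=
  X.c s a + ∑ k, l k * (X.d k s a - X.q k)

/-- The `Q`-function `Q^{π,l}(s,a)` of a stationary policy. -/
def qFun (X : CMDP S A K) (π : StationaryPolicy S A) (l : EuclideanSpace ℝ (Fin K))
    (s : S) (a : A) : ℝ :=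
  X.discounted (X.modCost l) π (Measure.dirac (s, a))

/-- The `Q`-function of a mixing policy (the initial randomization is averaged out). -/
def qFunMix (X : CMDP S A K) (ρ : Measure (StationaryPolicy S A))
    (l : EuclideanSpace ℝ (Fin K)) (s : S) (a : A) : ℝ :=
  ∫ π, X.qFun π l s a ∂ρ

/-- The occupation measure of a stationary policy,
`ν^π = (1 - γ) ∑ₜ γ^t P^π((s_t, a_t) ∈ ·)` with `s_0 ∼ μ₀`. -/
def occ (X : CMDP S A K) (π : StationaryPolicy S A) : Measure (S × A) :=
  Measure.sum fun t : ℕ => ENNReal.ofReal ((1 - X.γ) * X.γ ^ t) • X.law π (X.initLaw π) t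

/-- The occupation measure of a mixing policy. -/
def occMix (X : CMDP S A K) (ρ : Measure (StationaryPolicy S A)) : Measure (S × A) :=
  ρ.bind X.occ

/-- The stationary policy with occupation measure `ν`: `a ↦ ν(s,a) / ∑_{a'} ν(s,a')`
(the zero measure at the states `s` that `ν` does not charge). -/
def inducedPolicy (ν : Measure (S × A)) (s : S) : Measure A :=
  (cond ν (Prod.fst ⁻¹' {s})).map Prod.snd

/-- `Φ^ρ(ρ ‖ π₀)`: the Kullback-Leibler divergence from `π₀(· | s)` to the stationary policy
equivalent to the mixing policy `ρ`, averaged over the state occupation measure of `ρ`. -/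
def potential (X : CMDP S A K) (ρ : Measure (StationaryPolicy S A))
    (π₀ : StationaryPolicy S A) : ℝ≥0∞ :=
  ∫⁻ s, InformationTheory.klDiv (inducedPolicy (X.occMix ρ) s) (π₀ s : Measure A)
    ∂(X.occMix ρ).fst

/-- `ρ` is an optimal solution of the primal problem over mixing stationary policies:
minimize `C(ρ)` subject to `D(ρ) ≤ q`. -/
def IsPrimalOptimal (X : CMDP S A K) (ρ : Measure (StationaryPolicy S A)) : Prop :=
  IsProbabilityMeasure ρ ∧ (∀ k, X.auxCost ρ k ≤ X.q k) ∧
    ∀ ρ' : Measure (StationaryPolicy S A), IsProbabilityMeasure ρ' →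
      (∀ k, X.auxCost ρ' k ≤ X.q k) → X.cost ρ ≤ X.cost ρ'

/-- The dual function `l ↦ inf_ρ L(ρ, l)`, the infimum being over mixing stationary policies. -/
def dualFun (X : CMDP S A K) (l : EuclideanSpace ℝ (Fin K)) : EReal :=
  ⨅ ρ : ProbabilityMeasure (StationaryPolicy S A), ((X.lagrangian (ρ : Measure _) l : ℝ) : EReal)

/-- `l` maximizes the dual function over the nonnegative orthant. -/
def IsDualOptimal (X : CMDP S A K) (l : EuclideanSpace ℝ (Fin K)) : Prop :=
  (∀ k, 0 ≤ l k) ∧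
    ∀ l' : EuclideanSpace ℝ (Fin K), (∀ k, 0 ≤ l' k) → X.dualFun l' ≤ X.dualFun l

/-- All instantaneous costs are uniformly bounded from below. -/
def CostsBoundedBelow (X : CMDP S A K) : Prop :=
  ∃ W : ℝ, ∀ s a, W < X.c s a ∧ ∀ k, W < X.d k s a

/-- Slater's condition. -/
def Slater (X : CMDP S A K) : Prop :=
  ∃ ρ : Measure (StationaryPolicy S A), IsProbabilityMeasure ρ ∧ ∀ k, X.auxCost ρ k < X.q k

/-- The projection domain `{l ≥ 0 : ‖l‖ ≤ M + r}`. -/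
def dualDomain (K : ℕ) (M r : ℝ) : Set (EuclideanSpace ℝ (Fin K)) :=
  {l | (∀ k, 0 ≤ l k) ∧ ‖l‖ ≤ M + r}

/-- Subgradients `∂_l L(ρ, l) = D(ρ) - q` and `Q`-functions are (finite and) bounded by `G` for
multipliers in the set `Λ` and mixing stationary policies. -/
def BoundedSubgradient (X : CMDP S A K) (Λ : Set (EuclideanSpace ℝ (Fin K))) (G : ℝ) : Prop :=
  ∀ l ∈ Λ,
    (∀ (π : StationaryPolicy S A) (s : S) (a : A),
      X.FiniteDiscounted (X.modCost l) π (Measure.dirac (s, a))) ∧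
    ∀ ρ : Measure (StationaryPolicy S A), IsProbabilityMeasure ρ →
      ‖X.auxCost ρ - X.q‖ ≤ G ∧ ∀ s a, |X.qFunMix ρ l s a| ≤ G

/-- The sequences `(π_m, l_m)` are generated by the primal-dual algorithm with projection
domain `Λ` and step sizes `η`: `l_{m+1}` is the Euclidean projection onto `Λ` of
`l_m + η_m (D(π_m) - q)`, and `π_{m+1}(· | s) ∝ π_m(· | s) exp(-η_m Q^{π_m,l_m}(s, ·))`
(`Measure.tilted` is the normalized exponential reweighting). -/
structure IsPrimalDualRun (X : CMDP S A K) (Λ : Set (EuclideanSpace ℝ (Fin K))) (η : ℕ → ℝ)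
    (π : ℕ → StationaryPolicy S A) (l : ℕ → EuclideanSpace ℝ (Fin K)) : Prop where
  init_mem : l 0 ∈ Λ
  dual_mem : ∀ m, l (m + 1) ∈ Λ
  dual_proj : ∀ m, ∀ z ∈ Λ,
    ‖(l m + η m • (X.auxCost (Measure.dirac (π m)) - X.q)) - l (m + 1)‖ ≤
      ‖(l m + η m • (X.auxCost (Measure.dirac (π m)) - X.q)) - z‖
  policy_step : ∀ m s, (π (m + 1) s : Measure A) =
    (π m s : Measure A).tilted fun a => -(η m * X.qFun (π m) (l m) s a)

/-- The output of the algorithm: the mixing policy that executes `π_m`, `0 ≤ m < T`, with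
probability `η_m / ∑_{j<T} η_j`. -/
def output (η : ℕ → ℝ) (π : ℕ → StationaryPolicy S A) (T : ℕ) :
    Measure (StationaryPolicy S A) :=
  ∑ m ∈ Finset.range T,
    ENNReal.ofReal (η m / ∑ j ∈ Finset.range T, η j) • Measure.dirac (π m)

/-- The constraint violation `‖[D(ρ) - q]^+‖`. -/
def violation (X : CMDP S A K) (ρ : Measure (StationaryPolicy S A)) : ℝ :=
  ‖(WithLp.toLp 2 fun k => max (X.auxCost ρ k - X.q k) 0 : EuclideanSpace ℝ (Fin K))‖

/-- `max_{l ∈ Λ} ‖l - l₀‖²`. -/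
def sqRadius (Λ : Set (EuclideanSpace ℝ (Fin K))) (l₀ : EuclideanSpace ℝ (Fin K)) : ℝ :=
  sSup ((fun l => ‖l - l₀‖ ^ 2) '' Λ)

/-- The standing assumptions: costs bounded below, Slater's condition, subgradients bounded by
`G` on the domain `{l ≥ 0 : ‖l‖ ≤ M + r}`, a primal optimal `ρs`, a dual optimal `ls` with
`‖ls‖ ≤ M`, and sequences `(π_m, l_m)` generated by the algorithm with step sizes `η` from an
initial policy at finite divergence (if `Φ = ∞`, there is nothing to bound). -/
structure Setting (X : CMDP S A K) (M r G : ℝ) (ρs : Measure (StationaryPolicy S A))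
    (ls : EuclideanSpace ℝ (Fin K)) (η : ℕ → ℝ) (π : ℕ → StationaryPolicy S A)
    (l : ℕ → EuclideanSpace ℝ (Fin K)) : Prop where
  bounded_below : X.CostsBoundedBelow
  slater : X.Slater
  r_pos : 0 < r
  G_pos : 0 < G
  bounded_subgradient : X.BoundedSubgradient (dualDomain K M r) G
  primal_optimal : X.IsPrimalOptimal ρs
  dual_optimal : X.IsDualOptimal ls
  norm_le : ‖ls‖ ≤ M
  run : X.IsPrimalDualRun (dualDomain K M r) η π l
  finite_potential : X.potential ρs (π 0) ≠ ∞

end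

end CMDP

/-! The algorithm is a two-player no-regret scheme for the Lagrangian, and the averaged policy
inherits the sum of both regrets. The multiplier player runs projected subgradient ascent: expanding
the square and telescoping `‖l m - y‖ ^ 2` gives `dual_regret_le`. The policy player runs entropic
mirror descent separately at each state: an exponential tilt changes the divergence from a
comparator by a linear term plus a log-partition function, which Hoeffding's lemma controls.
Averaging over the states visited by the optimal policy turns these local regrets into a regret in
the Lagrangian. That is the performance difference lemma, which combines the Bellman equation with
the flow equation of the occupation measure and costs a factor `1 - γ` (`primal_regret_le`).

The comparator is a mixing policy, but only its occupation measure matters: disintegrating that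
measure yields the induced stationary policy appearing in the potential.

Strong duality comes from separating hyperplanes. The achievable (cost, constraint) pairs form a
convex set because policies can be mixed, and Slater's condition makes the separating functional
non-vertical; hence the primal and dual optima form a saddle point (`isSaddlePoint`). Together with
the two regrets this bounds the Lagrangian gap of the averaged policy against every multiplier in
the projection domain (`Setting.lagrangian_output_sub_le`). The multiplier `0` gives the upper cost
bound. Pushing `ls` by `r` along the violated constraints gives the violation bound, which is why
the domain extends beyond `M`. The saddle inequality with Cauchy-Schwarz gives the lower cost bound.

All interchanges of sums and integrals rest on `boundedCosts`: the lower bound on the costs and the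
bound on the Q-functions together force the costs to be bounded. -/

/-! ### Convex duality by separation -/

/-- Lagrange multipliers under Slater's condition, for a convex set of pairs
(objective value, constraint values). -/
theorem exists_lagrange_multiplier {ι : Type*} [Fintype ι] {V : Set (ℝ × (ι → ℝ))}
    (hV : Convex ℝ V) (hslater : ∃ v ∈ V, ∀ i, v.2 i < 0) {p : ℝ}
    (hp : ∀ v ∈ V, (∀ i, v.2 i ≤ 0) → p ≤ v.1) :
    ∃ y : ι → ℝ, (∀ i, 0 ≤ y i) ∧ ∀ v ∈ V, p ≤ v.1 + ∑ i, y i * v.2 i := by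
  classical
  -- Passing to strictly dominated points makes the set open, so that Hahn-Banach separates
  -- strictly, and upward closed, so that the separating functional has nonnegative coefficients.
  let O : Set (ℝ × (ι → ℝ)) := {w | ∃ v ∈ V, v.1 < w.1 ∧ ∀ i, v.2 i < w.2 i}
  have hO_open : IsOpen O := by
    have : O = ⋃ v ∈ V, {w : ℝ × (ι → ℝ) | v.1 < w.1 ∧ ∀ i, v.2 i < w.2 i} := by
      ext w; simp only [O, Set.mem_iUnion, Set.mem_ofPred_eq, exists_prop]
    rw [this]
    refine isOpen_biUnion fun v _ => ?_
    have hinter : {w : ℝ × (ι → ℝ) | v.1 < w.1 ∧ ∀ i, v.2 i < w.2 i}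
        = {w | v.1 < w.1} ∩ ⋂ i, {w | v.2 i < w.2 i} := by
      ext w; simp
    rw [hinter]
    exact (isOpen_lt continuous_const continuous_fst).inter (isOpen_iInter_of_finite fun i =>
      isOpen_lt continuous_const ((continuous_apply i).comp continuous_snd))
  have hO_convex : Convex ℝ O := by
    rintro w ⟨v, hv, hv1, hv2⟩ w' ⟨v', hv', hv1', hv2'⟩ a b ha hb hab
    refine ⟨a • v + b • v', hV hv hv' ha hb hab, ?_, fun i => ?_⟩
    · simp only [Prod.fst_add, Prod.smul_fst, smul_eq_mul]
      rcases ha.eq_or_lt with rfl | ha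
      · have : b = 1 := by linarith
        subst this; simpa using hv1'
      · nlinarith [mul_lt_mul_of_pos_left hv1 ha, mul_le_mul_of_nonneg_left hv1'.le hb]
    · simp only [Prod.snd_add, Prod.smul_snd, Pi.add_apply, Pi.smul_apply, smul_eq_mul]
      rcases ha.eq_or_lt with rfl | ha
      · have : b = 1 := by linarith
        subst this; simpa using hv2' i
      · nlinarith [mul_lt_mul_of_pos_left (hv2 i) ha, mul_le_mul_of_nonneg_left (hv2' i).le hb]
  have hpO : ((p, 0) : ℝ × (ι → ℝ)) ∉ O := by
    rintro ⟨v, hv, h1, h2⟩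
    exact absurd (hp v hv fun i => (h2 i).le) (not_le.2 h1)
  obtain ⟨f, hf⟩ := geometric_hahn_banach_point_open hO_convex hO_open hpO
  set α := f (1, 0) with hα
  set β : ι → ℝ := fun i => f (0, Pi.single i 1) with hβ
  have hfeq : ∀ (u : ℝ) (w : ι → ℝ), f (u, w) = u * α + ∑ i, w i * β i := by
    intro u w
    have h1 : ((u, w) : ℝ × (ι → ℝ)) = u • ((1, 0) : ℝ × (ι → ℝ))
        + ∑ i, w i • ((0, Pi.single i 1) : ℝ × (ι → ℝ)) := by
      ext j
      · simp [Prod.fst_sum]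
      · simp [Prod.snd_sum, Finset.sum_apply, Pi.single_apply]
    rw [h1, map_add, map_sum, map_smul]
    simp only [map_smul, smul_eq_mul, hα, hβ]
  have hlt : ∀ v ∈ V, ∀ (s : ℝ) (t : ι → ℝ), 0 < s → (∀ i, 0 < t i) →
      p * α < (v.1 + s) * α + ∑ i, (v.2 i + t i) * β i := by
    intro v hv s t hs ht
    have := hf (v.1 + s, v.2 + t) ⟨v, hv, by simpa using hs, fun i => by simpa using ht i⟩
    rw [hfeq, hfeq] at this
    simpa using this
  obtain ⟨v₀, hv₀, hneg⟩ := hslater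
  have hα0 : 0 ≤ α := by
    by_contra! h
    -- With a negative coefficient, raising that coordinate far enough, by about `|B| / (-α)`, would
    -- push the functional below its value at `(p, 0)`. The same argument serves for each `β i`.
    set B := v₀.1 * α + ∑ i, (v₀.2 i + 1) * β i - p * α with hB
    have := hlt v₀ hv₀ (|B| / (-α) + 1) (fun _ => 1)
      (by have : 0 < -α := by linarith
          positivity) (fun _ => one_pos)
    have h2 : (|B| / (-α) + 1) * α = -|B| + α := by field_simp [h.ne]
    have : 0 < B + (|B| / (-α) + 1) * α := by rw [hB]; linarith
    rw [h2] at this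
    linarith [le_abs_self B]
  have hβ0 : ∀ i, 0 ≤ β i := by
    intro i
    by_contra! h
    set B := (v₀.1 + 1) * α + ∑ j, (v₀.2 j + 1) * β j - p * α with hB
    have h0 : 0 ≤ |B| / (-β i) := div_nonneg (abs_nonneg _) (by linarith)
    have h1 := hlt v₀ hv₀ 1 (fun j => 1 + if j = i then |B| / (-β i) else 0) one_pos
      (fun j => by split_ifs <;> linarith)
    have h2 : |B| / (-β i) * β i = -|B| := by field_simp [h.ne]
    have h3 : ∑ j, (v₀.2 j + (1 + if j = i then |B| / (-β i) else 0)) * β j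
        = ∑ j, (v₀.2 j + 1) * β j + |B| / (-β i) * β i := by
      simp_rw [← add_assoc, add_mul _ (ite _ _ _), Finset.sum_add_distrib]
      simp
    rw [h3, h2] at h1
    linarith [le_abs_self B]
  have hαpos : 0 < α := by
    refine lt_of_le_of_ne hα0 fun h0 => ?_
    -- The Slater slack lifts the constraint values exactly to zero; were `α = 0`, the functional
    -- would vanish there and the strict separation would read `0 < 0`.
    have := hlt v₀ hv₀ 1 (fun i => -v₀.2 i) one_pos (fun i => by linarith [hneg i])
    rw [← h0] at this
    simp at this
  refine ⟨fun i => β i / α, fun i => div_nonneg (hβ0 i) hα0, fun v hv => ?_⟩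
  have hle : p * α ≤ v.1 * α + ∑ i, v.2 i * β i := by
    refine le_of_forall_pos_lt_add fun ε hε => ?_
    have hS : 0 < α + ∑ i, β i := add_pos_of_pos_of_nonneg hαpos (Finset.sum_nonneg fun i _ => hβ0 i)
    have := hlt v hv (ε / (α + ∑ i, β i)) (fun _ => ε / (α + ∑ i, β i)) (by positivity)
      (fun _ => by positivity)
    simp_rw [add_mul, Finset.sum_add_distrib, ← Finset.mul_sum] at this
    have h2 : ε / (α + ∑ i, β i) * α + ε / (α + ∑ i, β i) * ∑ i, β i = ε := by
      rw [← mul_add, div_mul_cancel₀ _ hS.ne']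
    linarith
  have : ∑ i, β i / α * v.2 i = (∑ i, v.2 i * β i) / α := by
    rw [Finset.sum_div]; exact Finset.sum_congr rfl fun i _ => by ring
  rw [this, ← sub_nonneg]
  have : v.1 + (∑ i, v.2 i * β i) / α - p = (v.1 * α + ∑ i, v.2 i * β i - p * α) / α := by
    field_simp
  rw [this]
  exact div_nonneg (by linarith) hα0

/-! ### One step of mirror descent and of projected subgradient ascent -/

/-- Hoeffding's lemma for the exponential moment of a function bounded by `G`. -/
theorem log_integral_exp_neg_mul_le {α : Type*} [MeasurableSpace α] {ν : Measure α}
    [IsProbabilityMeasure ν] {f : α → ℝ} (hf : Measurable f) {G : ℝ} (hG : ∀ x, |f x| ≤ G)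
    (η : ℝ) :
    Real.log (∫ x, Real.exp (-(η * f x)) ∂ν) ≤ -(η * ∫ x, f x ∂ν) + η ^ 2 * G ^ 2 / 2 := by
  have hb : ∀ᵐ x ∂ν, f x ∈ Set.Icc (-G) G := ae_of_all _ fun x => abs_le.1 (hG x)
  have h := (hasSubgaussianMGF_of_mem_Icc hf.aemeasurable hb).cgf_le (-η)
  have hcgf : cgf (fun x => f x - ∫ y, f y ∂ν) ν (-η)
      = Real.log (∫ x, Real.exp (-(η * f x)) ∂ν) + η * ∫ x, f x ∂ν := by
    have hint : Integrable (fun x => Real.exp (-(η * f x))) ν := by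
      simpa [neg_mul] using integrable_exp_mul_of_mem_Icc (t := -η) hf.aemeasurable hb
    have : ∀ x, Real.exp (-η * (f x - ∫ y, f y ∂ν))
        = Real.exp (-(η * f x)) * Real.exp (η * ∫ y, f y ∂ν) := fun x => by
      rw [← Real.exp_add]; ring_nf
    simp only [cgf, mgf]
    simp_rw [this]
    rw [integral_mul_const, Real.log_mul (integral_exp_pos hint).ne' (Real.exp_pos _).ne',
      Real.log_exp]
  rw [hcgf] at h
  -- The values lie in an interval of length `2G`, whose half-length squared is the sub-Gaussian
  -- parameter.
  have hc : (((‖G - -G‖₊ / 2) ^ 2 : NNReal) : ℝ) = G ^ 2 := by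
    push_cast
    rw [Real.norm_eq_abs, div_pow, sq_abs]; ring
  rw [hc] at h
  nlinarith [h]

/-- One step of entropic mirror descent, in terms of the Kullback-Leibler divergence. -/
theorem integral_llr_tilted_le {α : Type*} [MeasurableSpace α] {μ ν : Measure α}
    [IsProbabilityMeasure μ] [IsProbabilityMeasure ν] (hμν : μ ≪ ν)
    (hint : Integrable (llr μ ν) μ) {f : α → ℝ} (hf : Measurable f) {G : ℝ}
    (hG : ∀ x, |f x| ≤ G) (η : ℝ) :
    μ ≪ ν.tilted (fun x => -(η * f x)) ∧
      Integrable (llr μ (ν.tilted fun x => -(η * f x))) μ ∧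
      ∫ x, llr μ (ν.tilted fun x => -(η * f x)) x ∂μ ≤
        ∫ x, llr μ ν x ∂μ + η * (∫ x, f x ∂μ - ∫ x, f x ∂ν) + η ^ 2 * G ^ 2 / 2 := by
  have hb : ∀ᵐ x ∂ν, f x ∈ Set.Icc (-G) G := ae_of_all _ fun x => abs_le.1 (hG x)
  have hexp : Integrable (fun x => Real.exp (-(η * f x))) ν := by
    simpa [neg_mul] using integrable_exp_mul_of_mem_Icc (t := -η) hf.aemeasurable hb
  have hfμ : Integrable f μ :=
    Integrable.of_bound hf.aestronglyMeasurable G (ae_of_all _ hG)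
  have hfμ' : Integrable (fun x => -(η * f x)) μ := (hfμ.const_mul η).neg
  refine ⟨hμν.trans (absolutelyContinuous_tilted hexp),
    integrable_llr_tilted_right hμν hfμ' hint hexp, ?_⟩
  -- The change of divergence is an exact identity; only the log-partition function has to be
  -- estimated.
  rw [integral_llr_tilted_right hμν hfμ' hexp hint, integral_neg, integral_const_mul]
  linarith [log_integral_exp_neg_mul_le (ν := ν) hf hG η]

/-- One step of the projected subgradient method. -/
theorem norm_sub_sq_le_of_projection {E : Type*} [NormedAddCommGroup E] [InnerProductSpace ℝ E]
    {Λ : Set E} (hΛ : Convex ℝ Λ) {x y : E} (hy : y ∈ Λ)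
    (hproj : ∀ z ∈ Λ, ‖x - y‖ ≤ ‖x - z‖) {z : E} (hz : z ∈ Λ) : ‖y - z‖ ^ 2 ≤ ‖x - z‖ ^ 2 := by
  have hinf : ‖x - y‖ = ⨅ w : Λ, ‖x - w‖ := by
    have : Nonempty Λ := ⟨⟨y, hy⟩⟩
    refine le_antisymm (le_ciInf fun w => hproj w w.2) ?_
    exact ciInf_le ⟨0, by rintro _ ⟨w, rfl⟩; exact norm_nonneg _⟩ (⟨y, hy⟩ : Λ)
  have h := (norm_eq_iInf_iff_real_inner_le_zero hΛ hy).1 hinf z hz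
  -- The variational inequality says that `x - y` and `z - y` make an obtuse angle, so `‖x - z‖ ^ 2`
  -- dominates `‖y - z‖ ^ 2`.
  have h2 : x - z = (x - y) - (z - y) := by abel
  rw [h2, norm_sub_sq_real (x - y), ← norm_neg (y - z), neg_sub]
  nlinarith [sq_nonneg ‖x - y‖]

/-! ### Sums of step sizes -/

/-- Step sizes of order `1 / √m` are comparable to `1 / √(m + 1)` for all `m`. -/
theorem exists_bounds_of_isTheta_one_div_sqrt {η : ℕ → ℝ} (hpos : ∀ m, 0 < η m)
    (hη : η =Θ[atTop] fun m : ℕ => 1 / √(m : ℝ)) :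
    ∃ a b : ℝ, 0 < a ∧ 0 < b ∧ ∀ m : ℕ, a ≤ η m * √(m + 1 : ℝ) ∧ η m * √(m + 1 : ℝ) ≤ b := by
  obtain ⟨c₁, hc₁, h₁⟩ := hη.1.exists_pos
  obtain ⟨c₂, hc₂, h₂⟩ := hη.2.exists_pos
  obtain ⟨N, hN⟩ := eventually_atTop.1 ((h₁.bound.and h₂.bound).and (eventually_ge_atTop 1))
  set g : ℕ → ℝ := fun m => η m * √(m + 1 : ℝ) with hg
  have hgpos : ∀ m, 0 < g m := fun m => mul_pos (hpos m) (by positivity)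
  have hne : (Finset.range (N + 1)).Nonempty := ⟨0, by simp⟩
  have hbig : ∀ m, N ≤ m → 1 / c₂ ≤ g m ∧ g m ≤ c₁ * 2 := by
    intro m hm
    obtain ⟨⟨h1, h2⟩, h3⟩ := hN m hm
    have hm1 : (1 : ℝ) ≤ m := by exact_mod_cast h3
    have hs : 0 < √(m : ℝ) := Real.sqrt_pos.2 (by linarith)
    rw [Real.norm_of_nonneg (hpos m).le, Real.norm_of_nonneg (by positivity)] at h1 h2
    have hs1 : √(m : ℝ) ≤ √(m + 1 : ℝ) := Real.sqrt_le_sqrt (by linarith)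
    have hs2 : √(m + 1 : ℝ) ≤ 2 * √(m : ℝ) := by
      rw [Real.sqrt_le_left (by positivity), mul_pow, Real.sq_sqrt (by linarith)]; linarith
    constructor
    · rw [div_le_iff₀ hc₂]
      rw [div_le_iff₀ hs] at h2
      calc 1 ≤ c₂ * η m * √(m : ℝ) := h2
        _ ≤ c₂ * η m * √(m + 1 : ℝ) :=
          mul_le_mul_of_nonneg_left hs1 (mul_pos hc₂ (hpos m)).le
        _ = g m * c₂ := by simp only [hg]; ring
    · calc g m ≤ (c₁ * (1 / √(m : ℝ))) * (2 * √(m : ℝ)) :=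
          mul_le_mul h1 hs2 (Real.sqrt_nonneg _) (by positivity)
        _ = c₁ * 2 := by field_simp
  -- The asymptotic constants work from `N` on; the finitely many earlier indices enter through a
  -- minimum and a maximum of positive numbers.
  refine ⟨min (1 / c₂) ((Finset.range (N + 1)).inf' hne g),
    max (c₁ * 2) ((Finset.range (N + 1)).sup' hne g), ?_, ?_, fun m => ?_⟩
  · exact lt_min (by positivity) ((Finset.lt_inf'_iff _).2 fun i _ => hgpos i)
  · exact lt_max_of_lt_left (by positivity)
  · rcases le_total N m with hm | hm
    · exact ⟨(min_le_left _ _).trans (hbig m hm).1, (hbig m hm).2.trans (le_max_left _ _)⟩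
    · have hmem : m ∈ Finset.range (N + 1) := by simp; omega
      exact ⟨(min_le_right _ _).trans (Finset.inf'_le g hmem),
        (Finset.le_sup' g hmem).trans (le_max_right _ _)⟩

/-- Sums of step sizes of order `1 / √m` and of their squares. -/
theorem exists_sum_bounds_of_isTheta_one_div_sqrt {η : ℕ → ℝ} (hpos : ∀ m, 0 < η m)
    (hη : η =Θ[atTop] fun m : ℕ => 1 / √(m : ℝ)) :
    ∃ κ₁ κ₂ : ℝ, 0 < κ₁ ∧ 0 < κ₂ ∧ ∀ T : ℕ, 2 ≤ T →
      2 * (κ₁ * √(T : ℝ)) ≤ ∑ m ∈ Finset.range T, η m ∧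
      ∑ m ∈ Finset.range T, η m ^ 2 ≤ 5 / 8 * (κ₂ * Real.log T) := by
  obtain ⟨a, b, ha, hb, hab⟩ := exists_bounds_of_isTheta_one_div_sqrt hpos hη
  have hlog2 : 0 < Real.log 2 := Real.log_pos (by norm_num)
  -- Each of the `T` steps is at least `a / √T`, hence a sum of at least `a √T`. The squares sum to
  -- at most `b ^ 2 (1 + log T)`, and `T ≥ 2` allows `1 ≤ log T / log 2`; the `8 / 5` only cancels
  -- the `5 / 8`.
  refine ⟨a / 2, 8 / 5 * (b ^ 2 * (1 / Real.log 2 + 1)), by positivity, by positivity,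
    fun T hT => ⟨?_, ?_⟩⟩
  · have hT0 : (0 : ℝ) < T := by exact_mod_cast (by omega : 0 < T)
    have hsT : 0 < √(T : ℝ) := Real.sqrt_pos.2 hT0
    have : ∀ m ∈ Finset.range T, a / √(T : ℝ) ≤ η m := by
      intro m hm
      have hm' : (m : ℝ) + 1 ≤ T := by exact_mod_cast Finset.mem_range.1 hm
      rw [div_le_iff₀ hsT]
      exact (hab m).1.trans (mul_le_mul_of_nonneg_left (Real.sqrt_le_sqrt hm') (hpos m).le)
    have h := Finset.card_nsmul_le_sum _ _ _ this
    rw [Finset.card_range, nsmul_eq_mul] at h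
    refine le_trans (le_of_eq ?_) h
    have := Real.mul_self_sqrt hT0.le
    field_simp
    nlinarith
  · have hsq : ∀ m ∈ Finset.range T, η m ^ 2 ≤ b ^ 2 * (1 / ((m : ℝ) + 1)) := by
      intro m _
      have h0 : (0 : ℝ) < m + 1 := by positivity
      have h := pow_le_pow_left₀ (mul_nonneg (hpos m).le (Real.sqrt_nonneg _)) (hab m).2 2
      rw [mul_pow, Real.sq_sqrt h0.le] at h
      rw [mul_one_div, le_div_iff₀ h0]
      exact h
    have hlogT : Real.log 2 ≤ Real.log T :=
      Real.log_le_log (by norm_num) (by exact_mod_cast hT)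
    have hh : ∑ m ∈ Finset.range T, 1 / ((m : ℝ) + 1) ≤ 1 + Real.log T := by
      have := harmonic_le_one_add_log T
      simpa [harmonic, one_div] using this
    calc ∑ m ∈ Finset.range T, η m ^ 2
        ≤ ∑ m ∈ Finset.range T, b ^ 2 * (1 / ((m : ℝ) + 1)) := Finset.sum_le_sum hsq
      _ = b ^ 2 * ∑ m ∈ Finset.range T, 1 / ((m : ℝ) + 1) := by rw [Finset.mul_sum]
      _ ≤ b ^ 2 * (1 + Real.log T) := by gcongr
      _ ≤ b ^ 2 * (Real.log T / Real.log 2 + Real.log T) := by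
          gcongr
          rwa [le_div_iff₀ hlog2, one_mul]
      _ = 5 / 8 * (8 / 5 * (b ^ 2 * (1 / Real.log 2 + 1)) * Real.log T) := by ring

/-! ### Integration on countable spaces -/

theorem integrable_of_abs_le {α : Type*} [Countable α] [MeasurableSpace α]
    [MeasurableSingletonClass α] {μ : Measure α} [IsFiniteMeasure μ] {f : α → ℝ} {B : ℝ}
    (hf : ∀ x, |f x| ≤ B) : Integrable f μ :=
  Integrable.of_bound (measurable_of_countable f).aestronglyMeasurable B (ae_of_all _ hf)

theorem abs_integral_le_of_abs_le {α : Type*} [MeasurableSpace α] {μ : Measure α}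
    [IsProbabilityMeasure μ] {f : α → ℝ} {B : ℝ} (hf : ∀ x, |f x| ≤ B) : |∫ x, f x ∂μ| ≤ B := by
  simpa using norm_integral_le_of_norm_le_const (μ := μ) (f := f) (ae_of_all _ hf)

theorem integral_bind_kernel {α β : Type*} [MeasurableSpace α] [MeasurableSpace β]
    {μ : Measure α} {κ : Kernel α β} {f : β → ℝ}
    (hf : Integrable f (μ.bind κ)) : ∫ y, f y ∂(μ.bind κ) = ∫ x, ∫ y, f y ∂κ x ∂μ := by
  rw [Measure.comp_eq_comp_const_apply] at hf ⊢
  rw [Kernel.integral_comp hf]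
  simp

/-- Interchange of a discounted sum of uniformly bounded functions with an integral. -/
theorem integral_tsum_geometric {α : Type*} [Countable α] [MeasurableSpace α]
    [MeasurableSingletonClass α] {μ : Measure α} [IsProbabilityMeasure μ] {g : ℕ → α → ℝ} {B γ : ℝ}
    (h0 : 0 ≤ γ) (h1 : γ < 1) (hg : ∀ t x, |g t x| ≤ B) :
    ∫ x, ∑' t, γ ^ t * g t x ∂μ = ∑' t, γ ^ t * ∫ x, g t x ∂μ := by
  have hint : ∀ t, Integrable (g t) μ := fun t => integrable_of_abs_le (hg t)
  have hle : ∀ t, ∫ x, ‖γ ^ t * g t x‖ ∂μ ≤ γ ^ t * B := fun t => by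
    have : ∀ x, ‖γ ^ t * g t x‖ ≤ γ ^ t * B := fun x => by
      rw [norm_mul, Real.norm_of_nonneg (pow_nonneg h0 t)]
      exact mul_le_mul_of_nonneg_left (hg t x) (pow_nonneg h0 t)
    refine (le_abs_self _).trans (abs_integral_le_of_abs_le fun x => ?_)
    rw [abs_norm]
    exact this x
  rw [← integral_tsum_of_summable_integral_norm (fun t => (hint t).const_mul _)]
  · simp_rw [integral_const_mul]
  · exact Summable.of_nonneg_of_le (fun t => integral_nonneg fun x => norm_nonneg _) hle
      ((summable_geometric_of_lt_one h0 h1).mul_right B)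

/-- On a countable space the mass of a set is a countable sum of masses of atoms. -/
theorem MeasureTheory.Measure.measurable_of_measurable_singleton {α β : Type*} [Countable α]
    [MeasurableSpace α] [MeasurableSingletonClass α] [MeasurableSpace β] {f : β → Measure α}
    (hf : ∀ x, Measurable fun b => f b {x}) : Measurable f := by
  refine Measure.measurable_of_measurable_coe _ fun s hs => ?_
  have : ∀ b, f b s = ∑' x : s, f b {(x : α)} := fun b => by
    rw [← measure_biUnion s.to_countable (fun x _ y _ hxy => by simpa using hxy)
      (fun x _ => measurableSet_singleton x)]
    simp
  simp_rw [this]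
  exact Measurable.tsum fun x => hf x

/-! ### Trajectories, occupation measures and performance difference -/

namespace CMDP

noncomputable section

attribute [instance] CMDP.markov

section Basic

variable {S A : Type*} [MeasurableSpace S] [MeasurableSpace A] {K : ℕ}

theorem hasSum_weights (X : CMDP S A K) : HasSum (fun t : ℕ => (1 - X.γ) * X.γ ^ t) 1 := by
  have h := (hasSum_geometric_of_lt_one X.γ_pos.le X.γ_lt_one).mul_left (1 - X.γ)
  rwa [mul_inv_cancel₀ (by linarith [X.γ_lt_one])] at h

theorem weight_nonneg (X : CMDP S A K) (t : ℕ) : 0 ≤ (1 - X.γ) * X.γ ^ t :=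
  mul_nonneg (by linarith [X.γ_lt_one]) (pow_nonneg X.γ_pos.le t)

theorem inducedPolicy_isProbabilityMeasure [MeasurableSingletonClass S]
    (ν : Measure (S × A)) [IsFiniteMeasure ν] {s : S}
    (hs : ν.fst {s} ≠ 0) : IsProbabilityMeasure (inducedPolicy ν s) := by
  rw [Measure.fst_apply (measurableSet_singleton s)] at hs
  have := cond_isProbabilityMeasure hs
  exact Measure.isProbabilityMeasure_map measurable_snd.aemeasurable

theorem inducedPolicy_eq_zero [MeasurableSingletonClass S] {ν : Measure (S × A)} {s : S}
    (hs : ν.fst {s} = 0) : inducedPolicy ν s = 0 := by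
  rw [Measure.fst_apply (measurableSet_singleton s)] at hs
  simp [inducedPolicy, cond_eq_zero_of_meas_eq_zero hs]

theorem inducedPolicy_univ_le [MeasurableSingletonClass S] (ν : Measure (S × A))
    [IsFiniteMeasure ν] (s : S) : inducedPolicy ν s Set.univ ≤ 1 := by
  by_cases hs : ν.fst {s} = 0
  · simp [inducedPolicy_eq_zero hs]
  · have := inducedPolicy_isProbabilityMeasure ν hs
    exact prob_le_one

end Basic

section Trajectory

variable {S A : Type*} [Countable S] [MeasurableSpace S] [MeasurableSingletonClass S]
  [MeasurableSpace A] {K : ℕ}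

theorem policyKernel_apply (π : StationaryPolicy S A) (s : S) :
    policyKernel π s = (π s : Measure A) := rfl

instance (π : StationaryPolicy S A) : IsMarkovKernel (policyKernel π) :=
  ⟨fun s => by rw [policyKernel_apply]; infer_instance⟩

/-- The law of `(s_1, a_1)` when `(s_0, a_0)` has law `ν`. -/
def stepLaw (X : CMDP S A K) (π : StationaryPolicy S A) (ν : Measure (S × A)) :
    Measure (S × A) :=
  (ν.bind X.P) ⊗ₘ policyKernel π

instance (X : CMDP S A K) (π : StationaryPolicy S A) (ν : Measure (S × A))
    [IsProbabilityMeasure ν] : IsProbabilityMeasure (X.stepLaw π ν) := by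
  unfold stepLaw; infer_instance

instance (X : CMDP S A K) (π : StationaryPolicy S A) : IsProbabilityMeasure (X.initLaw π) := by
  unfold initLaw; infer_instance

theorem law_succ (X : CMDP S A K) (π : StationaryPolicy S A) (ν : Measure (S × A)) (t : ℕ) :
    X.law π ν (t + 1) = X.stepLaw π (X.law π ν t) := rfl

instance (X : CMDP S A K) (π : StationaryPolicy S A) (ν : Measure (S × A))
    [IsProbabilityMeasure ν] (t : ℕ) : IsProbabilityMeasure (X.law π ν t) := by
  induction t with
  | zero => assumption
  | succ t ih => rw [law_succ]; infer_instance

/-- Time-homogeneity: the recursion appends the last step, whereas the Bellman equation needs the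
first step absorbed into the initial law. -/
theorem law_succ' (X : CMDP S A K) (π : StationaryPolicy S A) (ν : Measure (S × A)) (t : ℕ) :
    X.law π ν (t + 1) = X.law π (X.stepLaw π ν) t := by
  induction t with
  | zero => rfl
  | succ t ih => rw [law_succ, ih, law_succ]

instance (X : CMDP S A K) (π : StationaryPolicy S A) : IsProbabilityMeasure (X.occ π) := by
  constructor
  rw [occ, Measure.sum_apply _ MeasurableSet.univ]
  simp only [Measure.smul_apply, measure_univ, smul_eq_mul, mul_one]
  rw [← ENNReal.ofReal_tsum_of_nonneg X.weight_nonneg X.hasSum_weights.summable,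
    X.hasSum_weights.tsum_eq, ENNReal.ofReal_one]

theorem summable_discounted (X : CMDP S A K) (π : StationaryPolicy S A) (ν : Measure (S × A))
    [IsProbabilityMeasure ν] {f : S → A → ℝ} {B : ℝ} (hf : ∀ s a, |f s a| ≤ B) :
    Summable fun t : ℕ => X.γ ^ t * ∫ x, f x.1 x.2 ∂(X.law π ν t) := by
  refine Summable.of_norm_bounded
    ((summable_geometric_of_lt_one X.γ_pos.le X.γ_lt_one).mul_right B) fun t => ?_
  rw [norm_mul, Real.norm_of_nonneg (pow_nonneg X.γ_pos.le t)]
  exact mul_le_mul_of_nonneg_left (abs_integral_le_of_abs_le fun x => hf x.1 x.2)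
    (pow_nonneg X.γ_pos.le t)

theorem discounted_eq_add (X : CMDP S A K) (π : StationaryPolicy S A) (ν : Measure (S × A))
    [IsProbabilityMeasure ν] {f : S → A → ℝ} {B : ℝ} (hf : ∀ s a, |f s a| ≤ B) :
    X.discounted f π ν =
      (1 - X.γ) * ∫ x, f x.1 x.2 ∂ν + X.γ * X.discounted f π (X.stepLaw π ν) := by
  rw [discounted, (X.summable_discounted π ν hf).tsum_eq_zero_add, discounted]
  simp_rw [law_succ', pow_succ', mul_assoc, tsum_mul_left]
  simp only [law, pow_zero, one_mul]
  ring

theorem abs_discounted_le (X : CMDP S A K) (π : StationaryPolicy S A) (ν : Measure (S × A))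
    [IsProbabilityMeasure ν] {f : S → A → ℝ} {B : ℝ} (hf : ∀ s a, |f s a| ≤ B) :
    |X.discounted f π ν| ≤ B := by
  have h1 : 0 < 1 - X.γ := by linarith [X.γ_lt_one]
  rw [discounted, abs_mul, abs_of_pos h1]
  have h : ‖∑' t : ℕ, X.γ ^ t * ∫ x, f x.1 x.2 ∂(X.law π ν t)‖ ≤ (1 - X.γ)⁻¹ * B := by
    refine tsum_of_norm_bounded
      ((hasSum_geometric_of_lt_one X.γ_pos.le X.γ_lt_one).mul_right B) fun t => ?_
    rw [norm_mul, Real.norm_of_nonneg (pow_nonneg X.γ_pos.le t)]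
    exact mul_le_mul_of_nonneg_left (abs_integral_le_of_abs_le fun x => hf x.1 x.2)
      (pow_nonneg X.γ_pos.le t)
  calc (1 - X.γ) * |∑' t : ℕ, X.γ ^ t * ∫ x, f x.1 x.2 ∂(X.law π ν t)|
      ≤ (1 - X.γ) * ((1 - X.γ)⁻¹ * B) := mul_le_mul_of_nonneg_left h h1.le
    _ = B := by field_simp

end Trajectory

section Countable

variable {S A : Type*} [Countable S] [MeasurableSpace S] [MeasurableSingletonClass S]
  [Countable A] [MeasurableSpace A] [MeasurableSingletonClass A] {K : ℕ}

theorem integral_stepLaw (X : CMDP S A K) (π : StationaryPolicy S A) (ν : Measure (S × A))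
    [IsProbabilityMeasure ν] {f : S × A → ℝ} {B : ℝ} (hf : ∀ x, |f x| ≤ B) :
    ∫ x, f x ∂(X.stepLaw π ν) =
      ∫ x, ∫ s, ∫ a, f (s, a) ∂(π s : Measure A) ∂(X.P x) ∂ν := by
  rw [stepLaw, Measure.integral_compProd (integrable_of_abs_le hf), integral_bind_kernel]
  · rfl
  · exact integrable_of_abs_le (B := B) fun s => abs_integral_le_of_abs_le fun a => hf _

theorem integral_stepLaw_dirac (X : CMDP S A K) (π : StationaryPolicy S A) (x : S × A)
    {f : S × A → ℝ} {B : ℝ} (hf : ∀ x, |f x| ≤ B) :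
    ∫ y, f y ∂(X.stepLaw π (Measure.dirac x)) =
      ∫ s, ∫ a, f (s, a) ∂(π s : Measure A) ∂(X.P x) := by
  rw [X.integral_stepLaw π _ hf, integral_dirac]

/-- The law at time `t` is linear in the initial law; the induction peels off the first step, so it
must range over all initial laws. -/
theorem integral_law_eq_integral_dirac (X : CMDP S A K) (π : StationaryPolicy S A)
    {f : S → A → ℝ} {B : ℝ} (hf : ∀ s a, |f s a| ≤ B) (t : ℕ) (ν : Measure (S × A))
    [IsProbabilityMeasure ν] :
    ∫ x, f x.1 x.2 ∂(X.law π ν t) =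
      ∫ y, ∫ x, f x.1 x.2 ∂(X.law π (Measure.dirac y) t) ∂ν := by
  induction t generalizing ν with
  | zero => simp [law]
  | succ t ih =>
    have hb : ∀ y : S × A, |∫ x, f x.1 x.2 ∂(X.law π (Measure.dirac y) t)| ≤ B := fun y =>
      abs_integral_le_of_abs_le fun x => hf _ _
    rw [law_succ', ih, X.integral_stepLaw π ν hb]
    refine integral_congr_ae (ae_of_all _ fun y => ?_)
    simp only
    rw [law_succ', ih, X.integral_stepLaw_dirac π y hb]

/-- The discounted cost is the average of the `Q`-function over the initial law. -/
theorem discounted_eq_integral_dirac (X : CMDP S A K) (π : StationaryPolicy S A)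
    (ν : Measure (S × A)) [IsProbabilityMeasure ν] {f : S → A → ℝ} {B : ℝ}
    (hf : ∀ s a, |f s a| ≤ B) :
    X.discounted f π ν = ∫ x, X.discounted f π (Measure.dirac x) ∂ν := by
  simp only [discounted]
  rw [integral_const_mul, integral_tsum_geometric X.γ_pos.le X.γ_lt_one (B := B)
    fun t x => abs_integral_le_of_abs_le fun y => hf _ _]
  simp_rw [← X.integral_law_eq_integral_dirac π hf]

theorem discounted_initLaw (X : CMDP S A K) (π : StationaryPolicy S A) {f : S → A → ℝ} {B : ℝ}
    (hf : ∀ s a, |f s a| ≤ B) :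
    X.discounted f π (X.initLaw π) =
      ∫ s, ∫ a, X.discounted f π (Measure.dirac (s, a)) ∂(π s : Measure A) ∂(X.μ₀ : Measure S) := by
  rw [X.discounted_eq_integral_dirac π _ hf, initLaw, Measure.integral_compProd]
  · rfl
  · exact integrable_of_abs_le fun x => X.abs_discounted_le π _ hf

/-- The Bellman equation for the `Q`-function. -/
theorem discounted_dirac (X : CMDP S A K) (π : StationaryPolicy S A) {f : S → A → ℝ} {B : ℝ}
    (hf : ∀ s a, |f s a| ≤ B) (x : S × A) :
    X.discounted f π (Measure.dirac x) = (1 - X.γ) * f x.1 x.2 +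
      X.γ * ∫ s, ∫ a, X.discounted f π (Measure.dirac (s, a)) ∂(π s : Measure A) ∂(X.P x) := by
  rw [X.discounted_eq_add π _ hf, integral_dirac, X.discounted_eq_integral_dirac π _ hf,
    X.integral_stepLaw_dirac π x (B := B) fun x => X.abs_discounted_le π _ hf]

theorem integral_occ (X : CMDP S A K) (π : StationaryPolicy S A) {f : S → A → ℝ} {B : ℝ}
    (hf : ∀ s a, |f s a| ≤ B) :
    ∫ x, f x.1 x.2 ∂(X.occ π) = X.discounted f π (X.initLaw π) := by
  have hint : Integrable (fun x : S × A => f x.1 x.2) (X.occ π) :=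
    integrable_of_abs_le fun x => hf _ _
  rw [occ] at hint ⊢
  rw [integral_sum_measure hint, discounted, ← tsum_mul_left]
  refine tsum_congr fun t => ?_
  rw [integral_smul_measure, ENNReal.toReal_ofReal (X.weight_nonneg t), smul_eq_mul, mul_assoc]

/-- The flow equation of the occupation measure of a stationary policy. -/
theorem integral_fst_occ (X : CMDP S A K) (π : StationaryPolicy S A) {h : S → ℝ} {B : ℝ}
    (hh : ∀ s, |h s| ≤ B) :
    ∫ x, h x.1 ∂(X.occ π) = (1 - X.γ) * ∫ s, h s ∂(X.μ₀ : Measure S) +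
      X.γ * ∫ x, ∫ s, h s ∂(X.P x) ∂(X.occ π) := by
  have hPh : ∀ s a, |∫ s', h s' ∂(X.P (s, a))| ≤ B := fun s a => abs_integral_le_of_abs_le hh
  have e1 := X.integral_occ π (f := fun s _ => h s) fun s _ => hh s
  have e2 := X.integral_occ π (f := fun s a => ∫ s', h s' ∂(X.P (s, a))) hPh
  simp only [Prod.mk.eta] at e2
  rw [e1, e2, discounted, (X.summable_discounted π _ fun s _ => hh s).tsum_eq_zero_add, discounted]
  have h0 : ∫ x, h x.1 ∂(X.law π (X.initLaw π) 0) = ∫ s, h s ∂(X.μ₀ : Measure S) := by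
    rw [law, initLaw, Measure.integral_compProd (integrable_of_abs_le fun x => hh x.1)]
    simp
  have hs : ∀ t, ∫ x, h x.1 ∂(X.law π (X.initLaw π) (t + 1)) =
      ∫ x, ∫ s', h s' ∂(X.P (x.1, x.2)) ∂(X.law π (X.initLaw π) t) := fun t => by
    rw [law_succ, X.integral_stepLaw π _ (f := fun x => h x.1) fun x => hh x.1]
    simp
  simp_rw [h0, hs, pow_succ', mul_assoc, tsum_mul_left]
  ring

/-- Each atom has mass `π(a | s)` times the mass of `s`, and both factors are measurable in the
policy. This makes occupation measures a kernel on policy space, so that they can be mixed. -/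
theorem measurable_law (X : CMDP S A K) (t : ℕ) :
    Measurable fun π : StationaryPolicy S A => X.law π (X.initLaw π) t := by
  have hpol : ∀ (s : S) (a : A),
      Measurable fun π : StationaryPolicy S A => (π s : Measure A) {a} := fun s a =>
    (Measure.measurable_coe (measurableSet_singleton a)).comp
      (measurable_subtype_coe.comp (measurable_pi_apply s))
  have hprod : ∀ (π : StationaryPolicy S A) (m : Measure S) [SFinite m] (x : S × A),
      (m ⊗ₘ policyKernel π) {x} = (π x.1 : Measure A) {x.2} * m {x.1} := by
    intro π m _ x
    rw [← Prod.mk.eta (p := x), ← Set.singleton_prod_singleton,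
      Measure.compProd_apply_prod (measurableSet_singleton _) (measurableSet_singleton _),
      lintegral_singleton]
    rfl
  induction t with
  | zero =>
    refine Measure.measurable_of_measurable_singleton fun x => ?_
    simp only [law, initLaw, hprod]
    exact (hpol _ _).mul_const _
  | succ t ih =>
    refine Measure.measurable_of_measurable_singleton fun x => ?_
    simp only [law_succ, stepLaw, hprod]
    refine (hpol _ _).mul ?_
    simp_rw [Measure.bind_apply (measurableSet_singleton _) X.P.measurable.aemeasurable]
    exact (Measure.measurable_lintegral (measurable_of_countable _)).comp ih

theorem measurable_occ (X : CMDP S A K) : Measurable (X.occ) := by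
  refine Measure.measurable_of_measurable_singleton fun x => ?_
  simp only [occ, Measure.sum_apply _ (measurableSet_singleton x), Measure.smul_apply, smul_eq_mul]
  exact Measurable.tsum fun t => ((Measure.measurable_coe
    (measurableSet_singleton x)).comp (X.measurable_law t)).const_mul _

/-- The occupation measures of stationary policies as a Markov kernel. -/
def occKernel (X : CMDP S A K) : Kernel (StationaryPolicy S A) (S × A) := ⟨X.occ, X.measurable_occ⟩

instance (X : CMDP S A K) : IsMarkovKernel X.occKernel :=
  ⟨fun π => inferInstanceAs (IsProbabilityMeasure (X.occ π))⟩

theorem occMix_eq (X : CMDP S A K) (ρ : Measure (StationaryPolicy S A)) :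
    X.occMix ρ = ρ.bind X.occKernel := rfl

instance (X : CMDP S A K) (ρ : Measure (StationaryPolicy S A)) [IsProbabilityMeasure ρ] :
    IsProbabilityMeasure (X.occMix ρ) := by
  rw [occMix_eq]; infer_instance

theorem integral_occMix (X : CMDP S A K) (ρ : Measure (StationaryPolicy S A))
    [IsProbabilityMeasure ρ] {f : S × A → ℝ} {B : ℝ} (hf : ∀ x, |f x| ≤ B) :
    ∫ x, f x ∂(X.occMix ρ) = ∫ π, ∫ x, f x ∂(X.occ π) ∂ρ :=
  integral_bind_kernel (κ := X.occKernel) (integrable_of_abs_le hf)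

theorem integrable_integral_occ (X : CMDP S A K) (ρ : Measure (StationaryPolicy S A))
    [IsProbabilityMeasure ρ] {f : S × A → ℝ} {B : ℝ} (hf : ∀ x, |f x| ≤ B) :
    Integrable (fun π => ∫ x, f x ∂(X.occ π)) ρ := by
  refine Integrable.of_bound ?_ B (ae_of_all _ fun π => abs_integral_le_of_abs_le hf)
  exact (StronglyMeasurable.integral_kernel (κ := X.occKernel)
    (measurable_of_countable f).stronglyMeasurable).aestronglyMeasurable

theorem integrable_discounted (X : CMDP S A K) (ρ : Measure (StationaryPolicy S A))
    [IsProbabilityMeasure ρ] {f : S → A → ℝ} {B : ℝ} (hf : ∀ s a, |f s a| ≤ B) :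
    Integrable (fun π => X.discounted f π (X.initLaw π)) ρ := by
  simp_rw [← X.integral_occ _ hf]
  exact X.integrable_integral_occ ρ (f := fun x => f x.1 x.2) fun x => hf _ _

theorem integral_discounted (X : CMDP S A K) (ρ : Measure (StationaryPolicy S A))
    [IsProbabilityMeasure ρ] {f : S → A → ℝ} {B : ℝ} (hf : ∀ s a, |f s a| ≤ B) :
    ∫ π, X.discounted f π (X.initLaw π) ∂ρ = ∫ x, f x.1 x.2 ∂(X.occMix ρ) := by
  simp_rw [← X.integral_occ _ hf]
  exact (X.integral_occMix ρ (f := fun x => f x.1 x.2) fun x => hf _ _).symm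

/-- The flow equation of the occupation measure of a mixing policy. -/
theorem integral_fst_occMix (X : CMDP S A K) (ρ : Measure (StationaryPolicy S A))
    [IsProbabilityMeasure ρ] {h : S → ℝ} {B : ℝ} (hh : ∀ s, |h s| ≤ B) :
    ∫ x, h x.1 ∂(X.occMix ρ) = (1 - X.γ) * ∫ s, h s ∂(X.μ₀ : Measure S) +
      X.γ * ∫ x, ∫ s, h s ∂(X.P x) ∂(X.occMix ρ) := by
  have hPh : ∀ x, |∫ s', h s' ∂(X.P x)| ≤ B := fun x => abs_integral_le_of_abs_le hh
  rw [X.integral_occMix ρ (f := fun x => h x.1) fun x => hh _, X.integral_occMix ρ hPh]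
  simp_rw [X.integral_fst_occ _ hh]
  rw [integral_add (integrable_const _) ((X.integrable_integral_occ ρ hPh).const_mul _),
    integral_const, probReal_univ, one_smul, integral_const_mul]

/-- The performance difference lemma, for a mixing policy against a stationary one. -/
theorem performance_difference (X : CMDP S A K) (ρ : Measure (StationaryPolicy S A))
    [IsProbabilityMeasure ρ] (π : StationaryPolicy S A) {f : S → A → ℝ} {B : ℝ}
    (hf : ∀ s a, |f s a| ≤ B) :
    ∫ x, X.discounted f π (Measure.dirac x) ∂(X.occMix ρ) -
        ∫ x, ∫ a, X.discounted f π (Measure.dirac (x.1, a)) ∂(π x.1 : Measure A) ∂(X.occMix ρ) =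
      (1 - X.γ) * (∫ x, f x.1 x.2 ∂(X.occMix ρ) - X.discounted f π (X.initLaw π)) := by
  have hV : ∀ s, |∫ a, X.discounted f π (Measure.dirac (s, a)) ∂(π s : Measure A)| ≤ B := fun s =>
    abs_integral_le_of_abs_le fun a => X.abs_discounted_le π _ hf
  have hPV : ∀ x, |∫ s, ∫ a, X.discounted f π (Measure.dirac (s, a)) ∂(π s : Measure A) ∂(X.P x)|
      ≤ B := fun x => abs_integral_le_of_abs_le hV
  have hint : Integrable (fun x : S × A => f x.1 x.2) (X.occMix ρ) :=
    integrable_of_abs_le fun x => hf _ _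
  rw [X.integral_fst_occMix ρ (h := fun s => ∫ a, X.discounted f π (Measure.dirac (s, a))
    ∂(π s : Measure A)) hV, X.discounted_initLaw π hf]
  -- With `V` the state value, the Bellman equation expands the first integral and the flow equation
  -- the second; the terms `γ ∫ P V` cancel, and the integral of `V` over `μ₀` is the discounted
  -- cost.
  conv_lhs => enter [1, 2, x]; rw [X.discounted_dirac π hf]
  rw [integral_add (hint.const_mul _) ((integrable_of_abs_le hPV).const_mul _),
    integral_const_mul, integral_const_mul]
  ring

/-- Disintegration of a finite measure along the policy it induces. -/
theorem integral_eq_integral_inducedPolicy (ν : Measure (S × A)) [IsFiniteMeasure ν]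
    {g : S × A → ℝ} {B : ℝ} (hg : ∀ x, |g x| ≤ B) :
    ∫ x, g x ∂ν = ∫ s, ∫ a, g (s, a) ∂(inducedPolicy ν s) ∂ν.fst := by
  let κ : Kernel S A := Kernel.ofFunOfCountable fun s => inducedPolicy ν s
  have hκ : ∀ s, κ s = inducedPolicy ν s := fun s => rfl
  have : IsFiniteKernel κ := ⟨⟨1, ENNReal.one_lt_top, fun s => inducedPolicy_univ_le ν s⟩⟩
  have hν : ν = ν.fst ⊗ₘ κ := by
    refine Measure.ext_of_singleton fun x => ?_
    have hfst : MeasurableSet (Prod.fst ⁻¹' {x.1} : Set (S × A)) :=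
      measurable_fst (measurableSet_singleton _)
    have hx : ({x} : Set (S × A)) = {x.1} ×ˢ {x.2} := by simp
    conv_rhs => rw [hx, Measure.compProd_apply_prod (measurableSet_singleton _)
      (measurableSet_singleton _), lintegral_singleton, hκ, inducedPolicy,
      Measure.map_apply measurable_snd (measurableSet_singleton _), cond_apply hfst,
      Measure.fst_apply (measurableSet_singleton _), mul_comm, ← mul_assoc]
    have hinter : (Prod.fst ⁻¹' {x.1} ∩ Prod.snd ⁻¹' {x.2} : Set (S × A)) = {x} := by
      ext y; simp [Prod.ext_iff]
    rw [hinter]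
    -- At uncharged states the induced policy is the zero measure, and both sides vanish.
    by_cases h0 : ν (Prod.fst ⁻¹' {x.1}) = 0
    · rw [h0, zero_mul, zero_mul]
      exact measure_mono_null (by simp) h0
    · rw [ENNReal.mul_inv_cancel h0 (measure_ne_top _ _), one_mul]
  conv_lhs => rw [hν]
  rw [Measure.integral_compProd (integrable_of_abs_le hg)]
  rfl

/-- A probability measure is determined by its countably many atoms. As `S` is countable, points of
policy space become measurable too, so integrals against a Dirac mass at a policy evaluate without
measurability of the integrand. -/
instance : MeasurableSingletonClass (ProbabilityMeasure A) := by
  refine ⟨fun μ => ?_⟩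
  have : ({μ} : Set (ProbabilityMeasure A)) =
      ⋂ a : A, (fun ν : ProbabilityMeasure A => (ν : Measure A) {a}) ⁻¹' {(μ : Measure A) {a}} := by
    ext ν
    simp only [Set.mem_singleton_iff, Set.mem_iInter, Set.mem_preimage]
    exact ⟨fun h a => by rw [h], fun h => Subtype.ext (Measure.ext_of_singleton h)⟩
  rw [this]
  exact MeasurableSet.iInter fun a => ((Measure.measurable_coe (measurableSet_singleton a)).comp
    measurable_subtype_coe) (measurableSet_singleton _)

end Countable

end

end CMDP

/-! ### Bounded costs, strong duality and the two regrets -/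

namespace CMDP

noncomputable section

section Costs

variable {S A : Type*} [MeasurableSpace S] [MeasurableSpace A] {K : ℕ}

/-- All instantaneous costs are bounded. -/
def BoundedCosts (X : CMDP S A K) : Prop :=
  ∃ B : ℝ, ∀ s a, |X.c s a| ≤ B ∧ ∀ k, |X.d k s a| ≤ B

theorem BoundedCosts.exists_abs_modCost_le {X : CMDP S A K} (h : X.BoundedCosts)
    (y : EuclideanSpace ℝ (Fin K)) : ∃ B : ℝ, ∀ s a, |X.modCost y s a| ≤ B := by
  obtain ⟨B, hB⟩ := h
  refine ⟨B + ∑ k, |y k| * (B + |X.q k|), fun s a => ?_⟩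
  refine (abs_add_le _ _).trans (add_le_add (hB s a).1 ?_)
  refine (Finset.abs_sum_le_sum_abs _ _).trans (Finset.sum_le_sum fun k _ => ?_)
  rw [abs_mul]
  exact mul_le_mul_of_nonneg_left
    ((abs_sub _ _).trans (add_le_add_left ((hB s a).2 k) _)) (abs_nonneg _)

end Costs

section Values

variable {S A : Type*} [Countable S] [MeasurableSpace S] [MeasurableSingletonClass S]
  [MeasurableSpace A] {K : ℕ}

theorem lagrangian_eq_cost_add_inner (X : CMDP S A K) (ρ : Measure (StationaryPolicy S A))
    (y : EuclideanSpace ℝ (Fin K)) :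
    X.lagrangian ρ y = X.cost ρ + inner ℝ y (X.auxCost ρ - X.q) := by
  simp [lagrangian, PiLp.inner_apply, mul_comm]

theorem lagrangian_zero (X : CMDP S A K) (ρ : Measure (StationaryPolicy S A)) :
    X.lagrangian ρ 0 = X.cost ρ := by simp [lagrangian]

theorem lagrangian_le_cost {X : CMDP S A K} {ρ : Measure (StationaryPolicy S A)}
    (hρ : ∀ k, X.auxCost ρ k ≤ X.q k) {y : EuclideanSpace ℝ (Fin K)} (hy : ∀ k, 0 ≤ y k) :
    X.lagrangian ρ y ≤ X.cost ρ := by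
  have : ∑ k, y k * (X.auxCost ρ k - X.q k) ≤ 0 :=
    Finset.sum_nonpos fun k _ => mul_nonpos_of_nonneg_of_nonpos (hy k) (by linarith [hρ k])
  rw [lagrangian]
  linarith

/-- A cost that is bounded below and whose discounted value is at most `G` is bounded above. -/
theorem le_of_discounted_le [MeasurableSingletonClass A] (X : CMDP S A K)
    {f : S → A → ℝ} {π : StationaryPolicy S A}
    {s : S} {a : A} (hfin : X.FiniteDiscounted f π (Measure.dirac (s, a))) {W G : ℝ}
    (hW : ∀ s a, W ≤ f s a) (hG : X.discounted f π (Measure.dirac (s, a)) ≤ G) :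
    f s a ≤ (G - X.γ * W) / (1 - X.γ) := by
  have h1 : 0 < 1 - X.γ := by linarith [X.γ_lt_one]
  have hγ := X.γ_pos.le
  have hsum : Summable fun t : ℕ =>
      X.γ ^ t * ∫ x, f x.1 x.2 ∂(X.law π (Measure.dirac (s, a)) t) := by
    refine Summable.of_norm_bounded hfin.2 fun t => ?_
    rw [norm_mul, Real.norm_of_nonneg (pow_nonneg hγ t)]
    exact mul_le_mul_of_nonneg_left (norm_integral_le_integral_norm _) (pow_nonneg hγ t)
  have hgeo := (hasSum_geometric_of_lt_one hγ X.γ_lt_one).mul_right (X.γ * W)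
  -- The terms from time `1` on contribute at least `γ W` to the normalized value, which leaves at
  -- most `G - γ W` for the initial cost.
  have hle : (1 - X.γ)⁻¹ * (X.γ * W) ≤ ∑' t : ℕ, X.γ ^ (t + 1) *
      ∫ x, f x.1 x.2 ∂(X.law π (Measure.dirac (s, a)) (t + 1)) := by
    rw [← hgeo.tsum_eq]
    refine hgeo.summable.tsum_le_tsum (fun t => ?_) ((summable_nat_add_iff 1).2 hsum)
    have hWt : W ≤ ∫ x, f x.1 x.2 ∂(X.law π (Measure.dirac (s, a)) (t + 1)) := by
      have := integral_mono (integrable_const W) (hfin.1 (t + 1)) fun x => hW x.1 x.2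
      simpa using this
    rw [pow_succ, mul_assoc]
    exact mul_le_mul_of_nonneg_left (mul_le_mul_of_nonneg_left hWt hγ) (pow_nonneg hγ t)
  rw [discounted, hsum.tsum_eq_zero_add] at hG
  simp only [law, integral_dirac, pow_zero, one_mul] at hG
  rw [le_div_iff₀ h1]
  have := mul_le_mul_of_nonneg_left hle h1.le
  rw [mul_inv_cancel_left₀ h1.ne'] at this
  simp only [law] at this
  linarith

theorem convex_dualDomain (K : ℕ) (M r : ℝ) : Convex ℝ (dualDomain K M r) := by
  intro x hx y hy a b ha hb hab
  refine ⟨fun k => ?_, ?_⟩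
  · simpa using add_nonneg (mul_nonneg ha (hx.1 k)) (mul_nonneg hb (hy.1 k))
  · have := (convex_closedBall (0 : EuclideanSpace ℝ (Fin K)) (M + r))
      (by simpa using hx.2) (by simpa using hy.2) ha hb hab
    simpa using this

theorem norm_sub_sq_le_sqRadius {M r : ℝ} (l₀ : EuclideanSpace ℝ (Fin K))
    {y : EuclideanSpace ℝ (Fin K)} (hy : y ∈ dualDomain K M r) :
    ‖y - l₀‖ ^ 2 ≤ sqRadius (dualDomain K M r) l₀ := by
  refine le_csSup ⟨(M + r + ‖l₀‖) ^ 2, ?_⟩ ⟨y, hy, rfl⟩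
  rintro _ ⟨z, hz, rfl⟩
  exact pow_le_pow_left₀ (norm_nonneg _)
    ((norm_sub_le _ _).trans (add_le_add_left hz.2 _)) 2

/-- Regret of the multiplier iterates against a fixed multiplier. -/
theorem dual_regret_le {X : CMDP S A K} {Λ : Set (EuclideanSpace ℝ (Fin K))} (hΛ : Convex ℝ Λ)
    {G : ℝ} {η : ℕ → ℝ} {π : ℕ → StationaryPolicy S A} {l : ℕ → EuclideanSpace ℝ (Fin K)}
    (hrun : X.IsPrimalDualRun Λ η π l)
    (hG : ∀ m, ‖X.auxCost (Measure.dirac (π m)) - X.q‖ ≤ G)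
    {y : EuclideanSpace ℝ (Fin K)} (hy : y ∈ Λ) (T : ℕ) :
    2 * ∑ m ∈ Finset.range T, η m * (X.lagrangian (Measure.dirac (π m)) y -
        X.lagrangian (Measure.dirac (π m)) (l m)) ≤
      ‖y - l 0‖ ^ 2 + G ^ 2 * ∑ m ∈ Finset.range T, η m ^ 2 := by
  -- The final distance must be kept for the telescoping induction and is dropped only at the end.
  suffices H : 2 * ∑ m ∈ Finset.range T, η m * (X.lagrangian (Measure.dirac (π m)) y -
      X.lagrangian (Measure.dirac (π m)) (l m)) ≤
      ‖l 0 - y‖ ^ 2 - ‖l T - y‖ ^ 2 + G ^ 2 * ∑ m ∈ Finset.range T, η m ^ 2 by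
    rw [norm_sub_rev y]
    linarith [sq_nonneg ‖l T - y‖]
  induction T with
  | zero => simp
  | succ T ih =>
    set g := X.auxCost (Measure.dirac (π T)) - X.q with hg
    have h1 := norm_sub_sq_le_of_projection hΛ (hrun.dual_mem T) (hrun.dual_proj T) hy
    have h2 : l T + η T • g - y = (l T - y) + η T • g := by abel
    rw [← hg, h2, norm_add_sq_real, inner_smul_right, norm_smul, mul_pow, Real.norm_eq_abs,
      sq_abs] at h1
    have h3 : η T ^ 2 * ‖g‖ ^ 2 ≤ η T ^ 2 * G ^ 2 :=
      mul_le_mul_of_nonneg_left (pow_le_pow_left₀ (norm_nonneg _) (hG T) 2) (sq_nonneg _)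
    have h4 : X.lagrangian (Measure.dirac (π T)) y - X.lagrangian (Measure.dirac (π T)) (l T)
        = -inner ℝ (l T - y) g := by
      rw [lagrangian_eq_cost_add_inner, lagrangian_eq_cost_add_inner, inner_sub_left, ← hg]
      ring
    rw [Finset.sum_range_succ, Finset.sum_range_succ, h4]
    nlinarith

end Values

variable {S A : Type*} [Countable S] [MeasurableSpace S] [MeasurableSingletonClass S]
  [Countable A] [MeasurableSpace A] [MeasurableSingletonClass A] {K : ℕ}

section Bounds

theorem abs_qFun_le {X : CMDP S A K} {Λ : Set (EuclideanSpace ℝ (Fin K))} {G : ℝ}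
    (h : X.BoundedSubgradient Λ G) {y : EuclideanSpace ℝ (Fin K)} (hy : y ∈ Λ)
    (π : StationaryPolicy S A) (s : S) (a : A) : |X.qFun π y s a| ≤ G := by
  have := ((h y hy).2 (Measure.dirac π) inferInstance).2 s a
  rwa [qFunMix, integral_dirac] at this

/-- The multiplier `0` isolates `c`, and `M + r` times the `k`-th unit vector then isolates `d k`.
In both cases the modified cost is bounded below and its Q-function is at most `G`, so it is bounded
above. -/
theorem boundedCosts (X : CMDP S A K) {M r G : ℝ} (hMr : 0 < M + r)
    (hbelow : X.CostsBoundedBelow) (hG : X.BoundedSubgradient (dualDomain K M r) G)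
    (π : StationaryPolicy S A) : X.BoundedCosts := by
  obtain ⟨W, hW⟩ := hbelow
  have hle : ∀ y ∈ dualDomain K M r, ∀ W' : ℝ, (∀ s a, W' ≤ X.modCost y s a) →
      ∀ s a, X.modCost y s a ≤ (G - X.γ * W') / (1 - X.γ) := fun y hy W' hW' s a =>
    X.le_of_discounted_le ((hG y hy).1 π s a) hW' ((le_abs_self _).trans (abs_qFun_le hG hy π s a))
  have hc : ∀ s a, X.c s a ≤ (G - X.γ * W) / (1 - X.γ) := by
    have := hle 0 ⟨by simp, by simpa using hMr.le⟩ W (by simpa [modCost] using fun s a => (hW s a).1.le)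
    simpa [modCost] using this
  have hd : ∀ k, ∃ U : ℝ, ∀ s a, X.d k s a ≤ U := by
    intro k
    set y : EuclideanSpace ℝ (Fin K) := EuclideanSpace.single k (M + r) with hy
    have hmod : ∀ s a, X.modCost y s a = X.c s a + (M + r) * (X.d k s a - X.q k) := by
      intro s a
      simp [modCost, hy]
    have hmem : y ∈ dualDomain K M r := by
      refine ⟨fun j => ?_, ?_⟩
      · simp only [hy, PiLp.single_apply]
        split_ifs
        · exact hMr.le
        · exact le_rfl
      · simp [hy, abs_of_pos hMr]
    set U := (G - X.γ * (W + (M + r) * (W - X.q k))) / (1 - X.γ)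
    have hU := hle y hmem (W + (M + r) * (W - X.q k)) fun s a => by
      rw [hmod]
      have := mul_le_mul_of_nonneg_left ((hW s a).2 k).le hMr.le
      nlinarith [(hW s a).1]
    refine ⟨(U - W) / (M + r) + X.q k, fun s a => ?_⟩
    have h1 := hU s a
    rw [hmod] at h1
    rw [← sub_le_iff_le_add, le_div_iff₀ hMr]
    nlinarith [(hW s a).1]
  choose U hU using hd
  set C := (G - X.γ * W) / (1 - X.γ)
  have hsum : ∀ k, |U k| ≤ ∑ j, |U j| := fun k =>
    Finset.single_le_sum (f := fun j => |U j|) (fun j _ => abs_nonneg _) (Finset.mem_univ k)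
  have hsum0 : 0 ≤ ∑ j, |U j| := Finset.sum_nonneg fun j _ => abs_nonneg _
  refine ⟨|W| + |C| + ∑ j, |U j|, fun s a => ⟨abs_le.2 ⟨?_, ?_⟩, fun k => abs_le.2 ⟨?_, ?_⟩⟩⟩
  · linarith [(hW s a).1, neg_abs_le W, abs_nonneg C]
  · linarith [hc s a, le_abs_self C, abs_nonneg W]
  · linarith [(hW s a).2 k, neg_abs_le W, abs_nonneg C]
  · linarith [hU k s a, le_abs_self (U k), hsum k, abs_nonneg W, abs_nonneg C]

end Bounds

section Lagrangian

/-- For a fixed multiplier the Lagrangian is linear in the occupation measure, the form in which the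
performance difference lemma applies. -/
theorem lagrangian_eq_integral_occMix {X : CMDP S A K} (h : X.BoundedCosts)
    (ρ : Measure (StationaryPolicy S A)) [IsProbabilityMeasure ρ]
    (y : EuclideanSpace ℝ (Fin K)) :
    X.lagrangian ρ y = ∫ x, X.modCost y x.1 x.2 ∂(X.occMix ρ) := by
  obtain ⟨B, hB⟩ := h
  have hc : Integrable (fun x : S × A => X.c x.1 x.2) (X.occMix ρ) :=
    integrable_of_abs_le fun x => (hB x.1 x.2).1
  have hd : ∀ k, Integrable (fun x : S × A => X.d k x.1 x.2) (X.occMix ρ) := fun k =>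
    integrable_of_abs_le fun x => (hB x.1 x.2).2 k
  have hdq : ∀ k, Integrable (fun x : S × A => y k * (X.d k x.1 x.2 - X.q k)) (X.occMix ρ) :=
    fun k => ((hd k).sub (integrable_const _)).const_mul _
  simp only [lagrangian, cost, auxCost, modCost]
  rw [integral_add hc (integrable_finsetSum _ fun k _ => hdq k),
    integral_finsetSum _ fun k _ => hdq k, X.integral_discounted ρ fun s a => (hB s a).1]
  congr 1
  refine Finset.sum_congr rfl fun k _ => ?_
  rw [integral_const_mul, integral_sub (hd k) (integrable_const _),
    X.integral_discounted ρ fun s a => (hB s a).2 k]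
  simp

theorem lagrangian_dirac {X : CMDP S A K} (h : X.BoundedCosts) (π : StationaryPolicy S A)
    (y : EuclideanSpace ℝ (Fin K)) :
    X.lagrangian (Measure.dirac π) y = X.discounted (X.modCost y) π (X.initLaw π) := by
  obtain ⟨B, hB⟩ := h.exists_abs_modCost_le y
  rw [lagrangian_eq_integral_occMix h, ← X.integral_discounted _ hB, integral_dirac]

/-- Costs are affine under mixing. -/
theorem exists_convexCombination {X : CMDP S A K} (h : X.BoundedCosts)
    (ρ ρ' : Measure (StationaryPolicy S A)) [IsProbabilityMeasure ρ] [IsProbabilityMeasure ρ']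
    {a b : ℝ} (ha : 0 ≤ a) (hb : 0 ≤ b) (hab : a + b = 1) :
    ∃ ρ'' : Measure (StationaryPolicy S A), IsProbabilityMeasure ρ'' ∧
      X.cost ρ'' = a * X.cost ρ + b * X.cost ρ' ∧
      ∀ k, X.auxCost ρ'' k = a * X.auxCost ρ k + b * X.auxCost ρ' k := by
  obtain ⟨B, hB⟩ := h
  have key : ∀ {f : S → A → ℝ}, (∀ s a, |f s a| ≤ B) →
      ∫ π, X.discounted f π (X.initLaw π) ∂(ENNReal.ofReal a • ρ + ENNReal.ofReal b • ρ') =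
      a * ∫ π, X.discounted f π (X.initLaw π) ∂ρ + b * ∫ π, X.discounted f π (X.initLaw π) ∂ρ' := by
    intro f hf
    rw [integral_add_measure
      ((X.integrable_discounted ρ hf).smul_measure ENNReal.ofReal_ne_top)
      ((X.integrable_discounted ρ' hf).smul_measure ENNReal.ofReal_ne_top),
      integral_smul_measure, integral_smul_measure, ENNReal.toReal_ofReal ha,
      ENNReal.toReal_ofReal hb, smul_eq_mul, smul_eq_mul]
  refine ⟨ENNReal.ofReal a • ρ + ENNReal.ofReal b • ρ', ⟨?_⟩,
    key fun s a => (hB s a).1, fun k => key fun s a => (hB s a).2 k⟩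
  simp [← ENNReal.ofReal_add ha hb, hab]

/-- Strong duality: `(ρs, ls)` is a saddle point of the Lagrangian, with value `C(ρs)`. -/
theorem isSaddlePoint {X : CMDP S A K} (h : X.BoundedCosts) (hslater : X.Slater)
    {ρs : Measure (StationaryPolicy S A)} (hρs : X.IsPrimalOptimal ρs)
    {ls : EuclideanSpace ℝ (Fin K)} (hls : X.IsDualOptimal ls) :
    (∀ y : EuclideanSpace ℝ (Fin K), (∀ k, 0 ≤ y k) → X.lagrangian ρs y ≤ X.lagrangian ρs ls) ∧
      ∀ ρ : Measure (StationaryPolicy S A), IsProbabilityMeasure ρ →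
        X.lagrangian ρs ls ≤ X.lagrangian ρ ls := by
  obtain ⟨hρs0, hfeas, hmin⟩ := hρs
  let V : Set (ℝ × (Fin K → ℝ)) := {v | ∃ ρ : Measure (StationaryPolicy S A),
    IsProbabilityMeasure ρ ∧ v.1 = X.cost ρ ∧ ∀ k, v.2 k = X.auxCost ρ k - X.q k}
  have hV : Convex ℝ V := by
    rintro v ⟨ρ, hρ, h1, h2⟩ v' ⟨ρ', hρ', h1', h2'⟩ a b ha hb hab
    obtain ⟨ρ'', hρ'', hC, hD⟩ := exists_convexCombination h ρ ρ' ha hb hab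
    refine ⟨ρ'', hρ'', by simp [hC, h1, h1'], fun k => ?_⟩
    simp only [Prod.snd_add, Prod.smul_snd, Pi.add_apply, Pi.smul_apply, smul_eq_mul, hD, h2, h2']
    linear_combination -X.q k * hab
  obtain ⟨y, hy0, hy⟩ := exists_lagrange_multiplier (p := X.cost ρs) hV
    (by
      obtain ⟨ρ, hρ, hlt⟩ := hslater
      exact ⟨(X.cost ρ, fun k => X.auxCost ρ k - X.q k), ⟨ρ, hρ, rfl, fun k => rfl⟩,
        fun k => sub_neg.2 (hlt k)⟩)
    (by
      rintro v ⟨ρ, hρ, h1, h2⟩ hle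
      rw [h1]
      exact hmin ρ hρ fun k => by linarith [hle k, h2 k])
  -- The multiplier found by separation need not be `ls`, but it bounds the dual value from below,
  -- and `ls` maximizes that value.
  have hdual : ((X.cost ρs : ℝ) : EReal) ≤ X.dualFun ls := by
    refine le_trans ?_ (hls.2 (WithLp.toLp 2 y) hy0)
    refine le_iInf fun ρ => EReal.coe_le_coe_iff.2 ?_
    exact hy (X.cost ρ, fun k => X.auxCost ρ k - X.q k) ⟨ρ, inferInstance, rfl, fun k => rfl⟩
  have hge : ∀ ρ : Measure (StationaryPolicy S A), IsProbabilityMeasure ρ →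
      X.cost ρs ≤ X.lagrangian ρ ls := fun ρ hρ =>
    EReal.coe_le_coe_iff.1 (hdual.trans (iInf_le _ (⟨ρ, hρ⟩ : ProbabilityMeasure _)))
  have heq : X.lagrangian ρs ls = X.cost ρs :=
    le_antisymm (lagrangian_le_cost hfeas hls.1) (hge ρs hρs0)
  rw [heq]
  exact ⟨fun y hy => lagrangian_le_cost hfeas hy, hge⟩

end Lagrangian

section Primal

/-- The pointwise mirror descent bound at a state charged by the comparator. -/
theorem integral_llr_policy_le {X : CMDP S A K} {G : ℝ} {η : ℕ → ℝ}
    {π : ℕ → StationaryPolicy S A} {l : ℕ → EuclideanSpace ℝ (Fin K)} {s : S}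
    (hstep : ∀ m, (π (m + 1) s : Measure A) =
      (π m s : Measure A).tilted fun a => -(η m * X.qFun (π m) (l m) s a))
    (hG : ∀ m a, |X.qFun (π m) (l m) s a| ≤ G) {μ : Measure A} [IsProbabilityMeasure μ]
    (hac : μ ≪ (π 0 s : Measure A)) (hint : Integrable (llr μ (π 0 s : Measure A)) μ) (T : ℕ) :
    μ ≪ (π T s : Measure A) ∧ Integrable (llr μ (π T s : Measure A)) μ ∧
      ∫ a, llr μ (π T s : Measure A) a ∂μ ≤ ∫ a, llr μ (π 0 s : Measure A) a ∂μ +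
        ∑ m ∈ Finset.range T, (η m * (∫ a, X.qFun (π m) (l m) s a ∂μ -
          ∫ a, X.qFun (π m) (l m) s a ∂(π m s : Measure A)) + η m ^ 2 * G ^ 2 / 2) := by
  induction T with
  | zero => simpa using ⟨hac, hint⟩
  | succ T ih =>
    obtain ⟨h1, h2, h3⟩ := ih
    obtain ⟨e1, e2, e3⟩ := integral_llr_tilted_le h1 h2
      (measurable_of_countable fun a => X.qFun (π T) (l T) s a) (hG T) (η T)
    rw [← hstep T] at e1 e2 e3
    refine ⟨e1, e2, ?_⟩
    rw [Finset.sum_range_succ]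
    linarith

/-- Regret of the policy iterates against a mixing policy. -/
theorem primal_regret_le {X : CMDP S A K} (h : X.BoundedCosts) {G : ℝ} {η : ℕ → ℝ}
    {π : ℕ → StationaryPolicy S A} {l : ℕ → EuclideanSpace ℝ (Fin K)}
    (hstep : ∀ m s, (π (m + 1) s : Measure A) =
      (π m s : Measure A).tilted fun a => -(η m * X.qFun (π m) (l m) s a))
    (hG : ∀ m s a, |X.qFun (π m) (l m) s a| ≤ G) (ρ : Measure (StationaryPolicy S A))
    [IsProbabilityMeasure ρ] (hΦ : X.potential ρ (π 0) ≠ ∞) (T : ℕ) :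
    (1 - X.γ) * ∑ m ∈ Finset.range T,
        η m * (X.lagrangian (Measure.dirac (π m)) (l m) - X.lagrangian ρ (l m)) ≤
      (X.potential ρ (π 0)).toReal + G ^ 2 / 2 * ∑ m ∈ Finset.range T, η m ^ 2 := by
  set ν := X.occMix ρ with hν
  set kl : S → ℝ≥0∞ := fun s =>
    InformationTheory.klDiv (inducedPolicy ν s) (π 0 s : Measure A) with hkl
  have hklm : AEMeasurable kl ν.fst := (measurable_of_countable kl).aemeasurable
  -- A finite average divergence is finite at almost every state, which supplies the absolute
  -- continuity and integrability needed to start mirror descent there.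
  have hfin : ∀ᵐ s ∂ν.fst, kl s < ∞ := ae_lt_top' hklm hΦ
  have hcharged : ∀ᵐ s ∂ν.fst, ν.fst {s} ≠ 0 := (ae_iff_of_countable).2 fun s hs => hs
  have hpt : ∀ᵐ s ∂ν.fst, 0 ≤ (kl s).toReal + ∑ m ∈ Finset.range T,
      (η m * (∫ a, X.qFun (π m) (l m) s a ∂(inducedPolicy ν s) -
          ∫ a, X.qFun (π m) (l m) s a ∂(π m s : Measure A)) + η m ^ 2 * G ^ 2 / 2) := by
    filter_upwards [hfin, hcharged] with s hs hs0
    have := inducedPolicy_isProbabilityMeasure ν hs0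
    obtain ⟨hac, hint⟩ := InformationTheory.klDiv_ne_top_iff.1 hs.ne
    obtain ⟨h1, h2, h3⟩ := integral_llr_policy_le (hstep · s) (hG · s) hac hint T
    -- The divergence from the last iterate is nonnegative, so the telescoped bound becomes a regret
    -- bound.
    have h4 := InformationTheory.integral_llr_add_sub_measure_univ_nonneg h1 h2
    simp only [probReal_univ, add_sub_cancel_right] at h4
    rw [hkl, InformationTheory.toReal_klDiv_of_measure_eq hac (by simp)]
    exact h4.trans h3
  have hQμ : ∀ m s, |∫ a, X.qFun (π m) (l m) s a ∂(inducedPolicy ν s)| ≤ G := by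
    intro m s
    have hG0 : 0 ≤ G := by
      obtain ⟨a⟩ := (π m s : Measure A).nonempty_of_neZero
      exact (abs_nonneg _).trans (hG m s a)
    by_cases hs : ν.fst {s} = 0
    · simpa [inducedPolicy_eq_zero hs] using hG0
    · have := inducedPolicy_isProbabilityMeasure ν hs
      exact abs_integral_le_of_abs_le (hG m s)
  have hQπ : ∀ m s, |∫ a, X.qFun (π m) (l m) s a ∂(π m s : Measure A)| ≤ G := fun m s =>
    abs_integral_le_of_abs_le (hG m s)
  have hsub : ∀ m, Integrable (fun s => ∫ a, X.qFun (π m) (l m) s a ∂(inducedPolicy ν s) -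
      ∫ a, X.qFun (π m) (l m) s a ∂(π m s : Measure A)) ν.fst := fun m =>
    (integrable_of_abs_le (hQμ m)).sub (integrable_of_abs_le (hQπ m))
  have hterm : ∀ m, Integrable (fun s => η m * (∫ a, X.qFun (π m) (l m) s a ∂(inducedPolicy ν s) -
      ∫ a, X.qFun (π m) (l m) s a ∂(π m s : Measure A)) + η m ^ 2 * G ^ 2 / 2) ν.fst := fun m =>
    ((hsub m).const_mul _).add (integrable_const _)
  have hI := integral_nonneg_of_ae hpt
  rw [integral_add (integrable_toReal_of_lintegral_ne_top hklm hΦ)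
    (integrable_finsetSum _ fun m _ => hterm m), integral_toReal hklm hfin,
    integral_finsetSum _ fun m _ => hterm m] at hI
  -- Disintegration reassembles the local advantages into integrals over the occupation measure, and
  -- performance difference identifies them with a Lagrangian gap times `1 - γ`.
  have hval : ∀ m, ∫ s, (η m * (∫ a, X.qFun (π m) (l m) s a ∂(inducedPolicy ν s) -
      ∫ a, X.qFun (π m) (l m) s a ∂(π m s : Measure A)) + η m ^ 2 * G ^ 2 / 2) ∂ν.fst =
      -((1 - X.γ) * (η m * (X.lagrangian (Measure.dirac (π m)) (l m) - X.lagrangian ρ (l m))))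
        + G ^ 2 / 2 * η m ^ 2 := by
    intro m
    obtain ⟨B, hB⟩ := h.exists_abs_modCost_le (l m)
    have hpd := X.performance_difference ρ (π m) hB
    rw [integral_add ((hsub m).const_mul _) (integrable_const _), integral_const_mul,
      integral_sub (integrable_of_abs_le (hQμ m)) (integrable_of_abs_le (hQπ m)),
      ← integral_eq_integral_inducedPolicy ν (g := fun x => X.qFun (π m) (l m) x.1 x.2)
        (fun x => hG m x.1 x.2), Measure.fst,
      integral_map measurable_fst.aemeasurable
        (measurable_of_countable _).aestronglyMeasurable]
    simp only [qFun, Prod.mk.eta] at hpd ⊢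
    rw [← hν] at hpd
    rw [hpd, lagrangian_dirac h, lagrangian_eq_integral_occMix h, integral_const]
    have : IsProbabilityMeasure (Measure.map Prod.fst ν) :=
      Measure.isProbabilityMeasure_map measurable_fst.aemeasurable
    simp only [probReal_univ, one_smul]
    ring
  rw [Finset.sum_congr rfl fun m _ => hval m, Finset.sum_add_distrib, Finset.sum_neg_distrib,
    ← Finset.mul_sum, ← Finset.mul_sum] at hI
  rw [potential]
  linarith

end Primal

end

end CMDP

/-! ### The averaged policy -/

namespace CMDP

noncomputable section

theorem inner_posPart {K : ℕ} (g : EuclideanSpace ℝ (Fin K)) :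
    inner ℝ (WithLp.toLp 2 fun k => max (g k) 0 : EuclideanSpace ℝ (Fin K)) g =
      ‖(WithLp.toLp 2 fun k => max (g k) 0 : EuclideanSpace ℝ (Fin K))‖ ^ 2 := by
  rw [EuclideanSpace.norm_sq_eq, PiLp.inner_apply]
  refine Finset.sum_congr rfl fun k _ => ?_
  rcases le_total (g k) 0 with hk | hk <;> simp [hk, sq]

theorem isProbabilityMeasure_output {S A : Type*} [MeasurableSpace A] {η : ℕ → ℝ}
    (hη : ∀ m, 0 < η m) (π : ℕ → StationaryPolicy S A) {T : ℕ} (hT : 1 ≤ T) :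
    IsProbabilityMeasure (output η π T) := by
  have hH : 0 < ∑ j ∈ Finset.range T, η j :=
    Finset.sum_pos (fun j _ => hη j) ⟨0, Finset.mem_range.2 hT⟩
  constructor
  simp only [output, Measure.coe_finsetSum, Finset.sum_apply, Measure.smul_apply, measure_univ,
    smul_eq_mul, mul_one]
  rw [← ENNReal.ofReal_sum_of_nonneg fun m _ => div_nonneg (hη m).le hH.le, ← Finset.sum_div,
    div_self hH.ne', ENNReal.ofReal_one]

section Setting

variable {S A : Type*} [Countable S] [MeasurableSpace S] [MeasurableSingletonClass S]
  [MeasurableSpace A] {K : ℕ}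

namespace Setting

variable {X : CMDP S A K} {M r G : ℝ} {ρs : Measure (StationaryPolicy S A)}
  {ls : EuclideanSpace ℝ (Fin K)} {η : ℕ → ℝ} {π : ℕ → StationaryPolicy S A}
  {l : ℕ → EuclideanSpace ℝ (Fin K)}

theorem radius_pos (h : X.Setting M r G ρs ls η π l) : 0 < M + r :=
  add_pos_of_nonneg_of_pos ((norm_nonneg _).trans h.norm_le) h.r_pos

theorem dual_mem (h : X.Setting M r G ρs ls η π l) : ∀ m, l m ∈ dualDomain K M r
  | 0 => h.run.init_mem
  | m + 1 => h.run.dual_mem m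

end Setting

end Setting

variable {S A : Type*} [Countable S] [MeasurableSpace S] [MeasurableSingletonClass S]
  [Countable A] [MeasurableSpace A] [MeasurableSingletonClass A] {K : ℕ}

theorem lagrangian_output {X : CMDP S A K} (h : X.BoundedCosts) {η : ℕ → ℝ}
    (hη : ∀ m, 0 < η m) (π : ℕ → StationaryPolicy S A) {T : ℕ} (hT : 1 ≤ T)
    (y : EuclideanSpace ℝ (Fin K)) :
    (∑ m ∈ Finset.range T, η m) * X.lagrangian (output η π T) y =
      ∑ m ∈ Finset.range T, η m * X.lagrangian (Measure.dirac (π m)) y := by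
  have hH : 0 < ∑ j ∈ Finset.range T, η j :=
    Finset.sum_pos (fun j _ => hη j) ⟨0, Finset.mem_range.2 hT⟩
  obtain ⟨B, hB⟩ := h.exists_abs_modCost_le y
  have := isProbabilityMeasure_output hη π hT
  rw [lagrangian_eq_integral_occMix h, ← X.integral_discounted _ hB, output,
    integral_finsetSum_measure fun m _ =>
      (X.integrable_discounted _ hB).smul_measure ENNReal.ofReal_ne_top, Finset.mul_sum]
  refine Finset.sum_congr rfl fun m _ => ?_
  rw [integral_smul_measure, integral_dirac, lagrangian_dirac h,
    ENNReal.toReal_ofReal (div_nonneg (hη m).le hH.le), smul_eq_mul, ← mul_assoc,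
    mul_div_cancel₀ _ hH.ne']

namespace Setting

variable {X : CMDP S A K} {M r G : ℝ} {ρs : Measure (StationaryPolicy S A)}
  {ls : EuclideanSpace ℝ (Fin K)} {η : ℕ → ℝ} {π : ℕ → StationaryPolicy S A}
  {l : ℕ → EuclideanSpace ℝ (Fin K)}

theorem boundedCosts (h : X.Setting M r G ρs ls η π l) : X.BoundedCosts :=
  X.boundedCosts h.radius_pos h.bounded_below h.bounded_subgradient (π 0)

theorem saddle (h : X.Setting M r G ρs ls η π l) :
    (∀ y : EuclideanSpace ℝ (Fin K), (∀ k, 0 ≤ y k) → X.lagrangian ρs y ≤ X.lagrangian ρs ls) ∧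
      ∀ ρ : Measure (StationaryPolicy S A), IsProbabilityMeasure ρ →
        X.lagrangian ρs ls ≤ X.lagrangian ρ ls :=
  isSaddlePoint h.boundedCosts h.slater h.primal_optimal h.dual_optimal

/-- The primal-dual regret bound for the averaged policy against a multiplier `y`. -/
theorem lagrangian_output_sub_le (h : X.Setting M r G ρs ls η π l) (hη : ∀ m, 0 < η m) {T : ℕ}
    (hT : 1 ≤ T) {y : EuclideanSpace ℝ (Fin K)} (hy : y ∈ dualDomain K M r) :
    (∑ m ∈ Finset.range T, η m) * (X.lagrangian (output η π T) y - X.lagrangian ρs ls) ≤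
      ‖y - l 0‖ ^ 2 / 2 + G ^ 2 / 2 * ∑ m ∈ Finset.range T, η m ^ 2 +
        ((X.potential ρs (π 0)).toReal + G ^ 2 / 2 * ∑ m ∈ Finset.range T, η m ^ 2) /
          (1 - X.γ) := by
  have h1 : 0 < 1 - X.γ := by linarith [X.γ_lt_one]
  have := h.primal_optimal.1
  have hP := primal_regret_le h.boundedCosts h.run.policy_step
    (fun m s a => abs_qFun_le h.bounded_subgradient (h.dual_mem m) (π m) s a) ρs
    h.finite_potential T
  rw [← le_div_iff₀' h1] at hP
  have hD := dual_regret_le (convex_dualDomain K M r) h.run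
    (fun m => ((h.bounded_subgradient _ (h.dual_mem m)).2 _ inferInstance).1) hy T
  -- Inserting `L(π_m, l_m)` separates the two regrets; replacing `L(ρs, ls)` by the smaller `L(ρs,
  -- l_m)` is the saddle inequality in the multiplier.
  have hsum : ∑ m ∈ Finset.range T,
      η m * (X.lagrangian (Measure.dirac (π m)) y - X.lagrangian ρs ls) ≤
      ∑ m ∈ Finset.range T, η m * (X.lagrangian (Measure.dirac (π m)) y -
        X.lagrangian (Measure.dirac (π m)) (l m)) +
      ∑ m ∈ Finset.range T, η m * (X.lagrangian (Measure.dirac (π m)) (l m) -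
        X.lagrangian ρs (l m)) := by
    rw [← Finset.sum_add_distrib]
    refine Finset.sum_le_sum fun m _ => ?_
    rw [← mul_add]
    refine mul_le_mul_of_nonneg_left ?_ (hη m).le
    linarith [h.saddle.1 (l m) (h.dual_mem m).1]
  have heq : (∑ m ∈ Finset.range T, η m) *
      (X.lagrangian (output η π T) y - X.lagrangian ρs ls) =
      ∑ m ∈ Finset.range T, η m * (X.lagrangian (Measure.dirac (π m)) y -
        X.lagrangian ρs ls) := by
    rw [mul_sub, lagrangian_output h.boundedCosts hη π hT, Finset.sum_mul,
      ← Finset.sum_sub_distrib]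
    simp_rw [mul_sub]
  rw [heq]
  linarith

theorem cost_output_sub_le (h : X.Setting M r G ρs ls η π l) (hη : ∀ m, 0 < η m) {T : ℕ}
    (hT : 1 ≤ T) :
    (∑ m ∈ Finset.range T, η m) * (X.cost (output η π T) - X.lagrangian ρs ls) ≤
      ‖l 0‖ ^ 2 / 2 + G ^ 2 / 2 * ∑ m ∈ Finset.range T, η m ^ 2 +
        ((X.potential ρs (π 0)).toReal + G ^ 2 / 2 * ∑ m ∈ Finset.range T, η m ^ 2) /
          (1 - X.γ) := by
  have := h.lagrangian_output_sub_le hη hT (y := 0) ⟨by simp, by simpa using h.radius_pos.le⟩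
  rwa [lagrangian_zero, zero_sub, norm_neg] at this

/-- Moving `ls` by `r` in the direction of the positive part of `D - q` raises the Lagrangian of the
averaged policy by `r` times the violation, while at `ls` it is already at least the saddle value.
-/
theorem violation_output_le (h : X.Setting M r G ρs ls η π l) (hη : ∀ m, 0 < η m) {T : ℕ}
    (hT : 1 ≤ T) :
    (∑ m ∈ Finset.range T, η m) * (r * X.violation (output η π T)) ≤
      sqRadius (dualDomain K M r) (l 0) / 2 + G ^ 2 / 2 * ∑ m ∈ Finset.range T, η m ^ 2 +
        ((X.potential ρs (π 0)).toReal + G ^ 2 / 2 * ∑ m ∈ Finset.range T, η m ^ 2) /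
          (1 - X.γ) := by
  set g := X.auxCost (output η π T) - X.q with hg
  set v : EuclideanSpace ℝ (Fin K) := WithLp.toLp 2 fun k => max (g k) 0 with hv
  have hviol : X.violation (output η π T) = ‖v‖ := rfl
  have hr := h.r_pos
  -- When nothing is violated the quotient is `0` by convention and `y = ls`.
  set y := ls + (r / ‖v‖) • v with hy
  have hymem : y ∈ dualDomain K M r := by
    refine ⟨fun k => ?_, ?_⟩
    · have : 0 ≤ v k := le_max_right _ _
      simpa [hy] using add_nonneg (h.dual_optimal.1 k)
        (mul_nonneg (div_nonneg hr.le (norm_nonneg v)) this)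
    · refine (norm_add_le _ _).trans (add_le_add h.norm_le ?_)
      rw [norm_smul, Real.norm_of_nonneg (div_nonneg hr.le (norm_nonneg v))]
      rcases eq_or_ne ‖v‖ 0 with h0 | h0
      · simpa [h0] using hr.le
      · exact (div_mul_cancel₀ r h0).le
  have hlag : X.lagrangian (output η π T) y = X.lagrangian (output η π T) ls + r * ‖v‖ := by
    rw [lagrangian_eq_cost_add_inner, lagrangian_eq_cost_add_inner, ← hg, hy, inner_add_left,
      real_inner_smul_left, inner_posPart, ← hv]
    rcases eq_or_ne ‖v‖ 0 with h0 | h0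
    · simp [h0]
    · field_simp
      ring
  have hle := h.lagrangian_output_sub_le hη hT hymem
  have hge := h.saddle.2 _ (isProbabilityMeasure_output hη π hT)
  have hR := norm_sub_sq_le_sqRadius (l 0) hymem
  have hH : 0 ≤ ∑ m ∈ Finset.range T, η m := Finset.sum_nonneg fun m _ => (hη m).le
  rw [hviol]
  have := mul_le_mul_of_nonneg_left (a := ∑ m ∈ Finset.range T, η m)
    (show r * ‖v‖ ≤ X.lagrangian (output η π T) y - X.lagrangian ρs ls by linarith) hH
  linarith

/-- The saddle inequality says that a policy can beat the optimal cost by at most `⟨ls, D - q⟩`;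
since `ls ≥ 0`, the positive part dominates and Cauchy-Schwarz applies. -/
theorem neg_le_cost_output_sub (h : X.Setting M r G ρs ls η π l) (hη : ∀ m, 0 < η m) {T : ℕ}
    (hT : 1 ≤ T) :
    -(‖ls‖ * X.violation (output η π T)) ≤ X.cost (output η π T) - X.lagrangian ρs ls := by
  set g := X.auxCost (output η π T) - X.q with hg
  set v : EuclideanSpace ℝ (Fin K) := WithLp.toLp 2 fun k => max (g k) 0 with hv
  have hviol : X.violation (output η π T) = ‖v‖ := rfl
  have hge := h.saddle.2 _ (isProbabilityMeasure_output hη π hT)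
  rw [lagrangian_eq_cost_add_inner X (output η π T), ← hg] at hge
  have h1 : inner ℝ ls g ≤ inner ℝ ls v := by
    rw [PiLp.inner_apply, PiLp.inner_apply]
    refine Finset.sum_le_sum fun k _ => ?_
    simpa using mul_le_mul_of_nonneg_right (le_max_left (g k) 0) (h.dual_optimal.1 k)
  rw [hviol]
  linarith [real_inner_le_norm ls v]

end Setting

end

end CMDP

/-! ### Explicit rates -/

theorem mul_le_mul_one_div_of_mul_le {H x B D : ℝ} (hD : 0 < D) (hDH : D ≤ H) (hB : 0 ≤ B)
    (h : H * x ≤ B) : x ≤ B * (1 / D) := by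
  rw [mul_one_div]
  refine (?_ : x ≤ B / H).trans (div_le_div_of_nonneg_left hB hD hDH)
  rwa [le_div_iff₀' (hD.trans_le hDH)]

theorem theorem1 :
    -- step sizes of order `1 / √m`; `κ₁`, `κ₂` depend on the step sizes only
    (∀ η : ℕ → ℝ, (∀ m, 0 < η m) → (η =Θ[atTop] fun m : ℕ => 1 / √(m : ℝ)) →
      ∃ κ₁ κ₂ : ℝ, 0 < κ₁ ∧ 0 < κ₂ ∧
        ∀ (S A : Type*) [Countable S] [MeasurableSpace S] [MeasurableSingletonClass S]
          [Countable A] [MeasurableSpace A] [MeasurableSingletonClass A] (K : ℕ)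
          (X : CMDP S A K) (M r G : ℝ) (ρs : Measure (StationaryPolicy S A))
          (ls : EuclideanSpace ℝ (Fin K)) (π : ℕ → StationaryPolicy S A)
          (l : ℕ → EuclideanSpace ℝ (Fin K)),
          X.Setting M r G ρs ls η π l →
          ∀ T : ℕ, 2 ≤ T →
            X.violation (CMDP.output η π T) ≤
              (CMDP.sqRadius (CMDP.dualDomain K M r) (l 0) + 5 / 8 * G ^ 2 * κ₂ * Real.log T
                + (X.potential ρs (π 0)).toReal) * (1 / (2 * r * (1 - X.γ) * κ₁ * √(T : ℝ))) ∧
            X.cost (CMDP.output η π T) - X.lagrangian ρs ls ≤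
              (5 / 8 * G ^ 2 * κ₂ * Real.log T + (X.potential ρs (π 0)).toReal
                + ‖l 0‖ ^ 2 / 2) * (1 / ((1 - X.γ) * κ₁ * √(T : ℝ))) ∧
            X.cost (CMDP.output η π T) - X.lagrangian ρs ls ≥
              -(‖ls‖ * ((CMDP.sqRadius (CMDP.dualDomain K M r) (l 0)
                + 5 / 8 * G ^ 2 * κ₂ * Real.log T + (X.potential ρs (π 0)).toReal) *
                  (1 / (2 * r * (1 - X.γ) * κ₁ * √(T : ℝ)))))) ∧
    -- constant step size
    (∀ (S A : Type*) [Countable S] [MeasurableSpace S] [MeasurableSingletonClass S]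
      [Countable A] [MeasurableSpace A] [MeasurableSingletonClass A] (K : ℕ)
      (X : CMDP S A K) (M r G η : ℝ) (ρs : Measure (StationaryPolicy S A))
      (ls : EuclideanSpace ℝ (Fin K)) (π : ℕ → StationaryPolicy S A)
      (l : ℕ → EuclideanSpace ℝ (Fin K)),
      0 < η → X.Setting M r G ρs ls (fun _ => η) π l →
      ∀ T : ℕ, 1 ≤ T →
        X.violation (CMDP.output (fun _ => η) π T) ≤
          (CMDP.sqRadius (CMDP.dualDomain K M r) (l 0)
            + 2 * (1 - X.γ)⁻¹ * (X.potential ρs (π 0)).toReal) * (1 / (2 * r * T * η))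
            + (1 + 1 / (1 - X.γ)) * (G ^ 2 * η / (2 * r)) ∧
        X.cost (CMDP.output (fun _ => η) π T) - X.lagrangian ρs ls ≤
          ((1 - X.γ)⁻¹ * (X.potential ρs (π 0)).toReal + ‖l 0‖ ^ 2 / 2) * (1 / (T * η))
            + (1 / 2 + 1 / (2 * (1 - X.γ))) * (G ^ 2 * η) ∧
        X.cost (CMDP.output (fun _ => η) π T) - X.lagrangian ρs ls ≥
          -(‖ls‖ * ((CMDP.sqRadius (CMDP.dualDomain K M r) (l 0)
            + 2 * (1 - X.γ)⁻¹ * (X.potential ρs (π 0)).toReal) * (1 / (2 * r * T * η))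
            + (1 + 1 / (1 - X.γ)) * (G ^ 2 * η / (2 * r))))) := by
  refine ⟨fun η hη hΘ => ?_, ?_⟩
  · obtain ⟨κ₁, κ₂, hκ₁, hκ₂, hsums⟩ := exists_sum_bounds_of_isTheta_one_div_sqrt hη hΘ
    refine ⟨κ₁, κ₂, hκ₁, hκ₂, ?_⟩
    intro S A _ _ _ _ _ _ K X M r G ρs ls π l h T hT
    obtain ⟨hH, hN⟩ := hsums T hT
    have hT1 : 1 ≤ T := by omega
    have hg : 0 < 1 - X.γ := by linarith [X.γ_lt_one]
    have hg1 : 1 - X.γ ≤ 1 := by linarith [X.γ_pos]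
    have hr := h.r_pos
    have hsT : 0 < √(T : ℝ) := Real.sqrt_pos.2 (by exact_mod_cast hT1)
    set H := ∑ m ∈ Finset.range T, η m with hHdef
    set N := ∑ m ∈ Finset.range T, η m ^ 2 with hNdef
    set Φ := (X.potential ρs (π 0)).toReal with hΦdef
    set R := CMDP.sqRadius (CMDP.dualDomain K M r) (l 0) with hRdef
    have hR0 : 0 ≤ R := (sq_nonneg _).trans (CMDP.norm_sub_sq_le_sqRadius (l 0) (h.dual_mem 0))
    have hΦ0 : 0 ≤ Φ := ENNReal.toReal_nonneg
    have hN0 : 0 ≤ N := Finset.sum_nonneg fun m _ => sq_nonneg _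
    have hκ : 0 < κ₁ * √(T : ℝ) := mul_pos hκ₁ hsT
    have hGN : G ^ 2 * N ≤ 5 / 8 * G ^ 2 * κ₂ * Real.log T :=
      (mul_le_mul_of_nonneg_left hN (sq_nonneg G)).trans_eq (by ring)
    have hGN0 : 0 ≤ G ^ 2 * N := mul_nonneg (sq_nonneg G) hN0
    have hgGN : (1 - X.γ) * (G ^ 2 * N) ≤ G ^ 2 * N := mul_le_of_le_one_left hGN0 hg1
    -- After multiplication by `1 - γ ≤ 1` the two halves of `G ^ 2 * N`, one from each regret, add
    -- up to at most the whole.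
    have hmul : ∀ a b : ℝ, (1 - X.γ) * (a / 2 + G ^ 2 / 2 * N + (b + G ^ 2 / 2 * N) / (1 - X.γ))
        = (1 - X.γ) * a / 2 + (1 - X.γ) * (G ^ 2 * N) / 2 + b + G ^ 2 * N / 2 := fun a b => by
      field_simp
      ring
    have hviol : X.violation (CMDP.output η π T) ≤
        (R + 5 / 8 * G ^ 2 * κ₂ * Real.log T + Φ) *
          (1 / (2 * r * (1 - X.γ) * κ₁ * √(T : ℝ))) := by
      refine mul_le_mul_one_div_of_mul_le (H := (1 - X.γ) * (H * r)) (by positivity) ?_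
        (by linarith) ?_
      · calc 2 * r * (1 - X.γ) * κ₁ * √(T : ℝ)
            = (1 - X.γ) * ((2 * (κ₁ * √(T : ℝ))) * r) := by ring
          _ ≤ (1 - X.γ) * (H * r) := by gcongr
      · have := mul_le_mul_of_nonneg_left (h.violation_output_le hη hT1) hg.le
        rw [hmul] at this
        have hgR : (1 - X.γ) * R ≤ R := mul_le_of_le_one_left hR0 hg1
        calc (1 - X.γ) * (H * r) * X.violation (CMDP.output η π T)
            = (1 - X.γ) * (H * (r * X.violation (CMDP.output η π T))) := by ring
          _ ≤ _ := by linarith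
    refine ⟨hviol, ?_, ?_⟩
    · refine mul_le_mul_one_div_of_mul_le (H := (1 - X.γ) * H) (by positivity) ?_
        (by linarith [sq_nonneg ‖l 0‖]) ?_
      · rw [mul_assoc]
        gcongr
        linarith
      · have := mul_le_mul_of_nonneg_left (h.cost_output_sub_le hη hT1) hg.le
        rw [hmul] at this
        have hgl : (1 - X.γ) * ‖l 0‖ ^ 2 ≤ ‖l 0‖ ^ 2 := mul_le_of_le_one_left (sq_nonneg _) hg1
        rw [mul_assoc]
        linarith
    · exact (neg_le_neg (mul_le_mul_of_nonneg_left hviol (norm_nonneg ls))).trans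
        (h.neg_le_cost_output_sub hη hT1)
  · intro S A _ _ _ _ _ _ K X M r G η ρs ls π l hη h T hT
    have hg : 0 < 1 - X.γ := by linarith [X.γ_lt_one]
    have hr := h.r_pos
    have hT0 : (0 : ℝ) < T := by exact_mod_cast hT
    have hV := h.violation_output_le (fun _ => hη) hT
    have hC := h.cost_output_sub_le (fun _ => hη) hT
    -- The sums are now exactly `T η` and `T η ^ 2`, so dividing by `T η` gives the stated
    -- right-hand sides with equality.
    simp only [Finset.sum_const, Finset.card_range, nsmul_eq_mul] at hV hC
    have hviol : X.violation (CMDP.output (fun _ => η) π T) ≤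
        (CMDP.sqRadius (CMDP.dualDomain K M r) (l 0)
          + 2 * (1 - X.γ)⁻¹ * (X.potential ρs (π 0)).toReal) * (1 / (2 * r * T * η))
          + (1 + 1 / (1 - X.γ)) * (G ^ 2 * η / (2 * r)) := by
      rw [← mul_assoc, ← le_div_iff₀' (by positivity)] at hV
      refine hV.trans_eq ?_
      field_simp
      ring
    refine ⟨hviol, ?_, ?_⟩
    · rw [← le_div_iff₀' (by positivity)] at hC
      refine hC.trans_eq ?_
      field_simp
      ring
    · exact (neg_le_neg (mul_le_mul_of_nonneg_left hviol (norm_nonneg ls))).trans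
        (h.neg_le_cost_output_sub (fun _ => hη) hT)
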